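/- **Model.** Fix sets of identifiers, role names, functions (used to build long-term keys, with an involutive inverse-key operation $f\mapsto f^{-1}$ on them), labels, agents (some of them trusted), intruder-generated terms $IT$, and an infinite set of run identifiers. *Role terms* are built from identifiers and role names by $f(x_1,\dots,x_n)$, pairing $(x,y)$ and encryption $\{x\}_y$; *run terms* are built in the same way from agents and *nonce run terms*, which are the elements of $IT$ and the terms $c\sharp rid$ ($c$ an identifier, $rid$ a run identifier). The inverse key of $f(t_1,\dots,t_n)$ is $f^{-1}(t_1,\dots,t_n)$; every other run term is its own inverse. An *event* is $\mathsf{create}_\ell(r)$, $\mathsf{send}_\ell(r,r',x)$, $\mathsf{read}_\ell(r',r,x)$, $\mathsf{claim}_\ell(r,cl[,x])$ or $\mathsf{end}_\ell(r)$, with a label $\ell$; here $r$ is the role executing the event, and $x$ is a role term. A *role specification* for $r$ is a list of events executed by $r$, beginning with its only create event and ending with its only end event, together with a partial typing of identifiers as constants, parameters or variables that is defined at every identifier in the list. A *protocol* $P$ is a partial map from role names $r$ to role specifications for $r$; its labels are unique, except that a send and a read event with the same sender and recipient may share a label. Its identifiers are those typed in one of its role specifications. In a *protocol set* each label is used in at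 most one protocol. An *instantiation* $inst=(rid,\rho,\sigma)$ consists of a run identifier, a partial map $\rho$ from roles to agents and a partial map $\sigma$ from identifiers to nonce run terms. In the context of a role specification it turns role terms into run terms (where defined): $r\mapsto\rho(r)$, a constant $c\mapsto c\sharp rid$, a parameter or variable $x\mapsto\sigma(x)$, and homomorphically on compound terms. A protocol set $\Pi$ is executed as follows. Initially the intruder knowledge is the closure of $IK_0(\Pi)$ under pairing, projection, encryption, and decryption with known inverse keys, and no run is active. A role $r$ of a protocol $P\in\Pi$ may be created with an unused $rid$, with $\rho$ defined exactly on $\mathrm{dom}(P)$ and $\sigma$ exactly on the parameters of $P(r)$; a run then executes its remaining events in order: a send of $m$ (possible if $inst(m)$ is defined) adds $inst(m)$ to the intruder knowledge, which is closed again; a read of $m$ extends $\sigma$ to exactly the variables of $m$ not yet assigned, so that $inst(m)$ becomes some term known to the intruder; claim and end events are always possible. A *trace* is the sequence of the executed run events $(inst,ev)$. The initial knowledge $IK_0(\Pi)$ contains $IT$, and no term $c\sharp rid$ occurs in its elements. $P$ *establishes* $c$ if, in all traces of all protocol sets containing $P$, $inst(c)$ is defined at every end event $(inst,\mathsf{end}(r))$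 of $P$. The *chaining composition* $P\cdot Q$ of $P,Q$ along $c,d$ is defined if $\mathrm{dom}(P)=\mathrm{dom}(Q)$, $P$ and $Q$ have no identifier in common, $P$ establishes $c$, and $d$ is a parameter in every role of $Q$. It maps $r\in \mathrm{dom}(P)$ to the events of $P(r)$ without the end event followed by those of $Q(r)[c/d]$ ($d$ replaced by $c$) without the create event, with the typing of $P(r)$ where it is defined and that of $Q(r)[c/d]$ elsewhere; events are relabelled injectively, $\ell\mapsto\ell'$. A trace satisfies the *unique-input restriction* if each create event of $Q$ can be matched injectively with an earlier end event of $P$ for the same role and with the same $\rho$, whose value of $c$ equals the value of $d$ at the create event. A protocol set *satisfies* a secrecy claim labelled $\ell$ (possibly for restricted traces) if in each of its (restricted) traces, whenever $(inst,\mathsf{claim}_\ell(r,\mathsf{secret},m))$ occurs, $inst(m)$ (if defined) is not in the intruder knowledge at the end of the trace, or $\rho$ has an untrusted agent in its image. **Theorem.** Let $P,Q$ be protocols whose chaining composition $P\cdot Q$ along $c,d$ is defined. Let $\Pi$ be a set of protocols with $P,Q\notin\Pi$, such that $\{P,Q\}\cup\Pi$ and $\{P\cdot Q\}\cup\Pi$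 are protocol sets, and assume that $IK_0(\{P\cdot Q\}\cup\Pi)\subseteq IK_0(\{P,Q\}\cup\Pi)$ (composing does not enlarge the initial intruder knowledge). Let $\ell$ be the label of a secrecy claim event in $P$ or $Q$, and $\ell'$ the corresponding label in $P\cdot Q$. If $\{P,Q\}\cup\Pi$, restricted to the traces that satisfy the unique-input restriction, satisfies the secrecy claim labelled $\ell$, then $\{P\cdot Q\}\cup\Pi$ satisfies the secrecy claim labelled $\ell'$ (in all its traces). -/

import Mathlib

namespace SecProt

/-- The basic sets of the protocol model: identifiers, role names, global functions (used to build
long-term keys), labels, agents with a set of trusted ones, intruder-generated terms, and run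
identifiers. `inv` sends a key constructor to the one of the inverse key (e.g. `pk ↔ sk`, while a
symmetric key constructor is fixed). There are always unused run identifiers. -/
structure Signature where
  Ident : Type*
  Role : Type*
  Func : Type*
  Label : Type*
  Agent : Type*
  IntruderTerm : Type*
  RunId : Type*
  inv : Func → Func
  inv_inv : ∀ f, inv (inv f) = f
  trusted : Set Agent
  runId_infinite : Infinite RunId

/-- Identifiers are constants (e.g. nonces), parameters (input) or variables (values read). -/
inductive IdentType
  | const
  | param
  | var

/-- Names of security claims. -/
inductive ClaimName
  | secret
  | sessionUnique
  | dataAgree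
  | session
  | weakSession
  | niSynch
  | iSynch

section Syntax_

variable (S : Signature)

/-- Role terms. -/
inductive RoleTerm
  | ident (x : S.Ident)
  | role (r : S.Role)
  | app (f : S.Func) (n : ℕ) (xs : Fin n → RoleTerm)
  | pair (x y : RoleTerm)
  | enc (x y : RoleTerm)

/-- Nonce run terms: `fresh c rid` is the constant `c` of the run `rid`. -/
inductive Nonce
  | fresh (c : S.Ident) (rid : S.RunId)
  | intruder (i : S.IntruderTerm)

/-- Run terms. -/
inductive RunTerm
  | agent (a : S.Agent)
  | nonce (n : Nonce S)
  | app (f : S.Func) (n : ℕ) (ts : Fin n → RunTerm)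
  | pair (t u : RunTerm)
  | enc (t u : RunTerm)

/-- Labelled events. In `send ℓ r r' x` and `read ℓ r r' x`, `r` is the sender and `r'` the
recipient. -/
inductive Event
  | create (ℓ : S.Label) (r : S.Role)
  | send (ℓ : S.Label) (r r' : S.Role) (x : RoleTerm S)
  | read (ℓ : S.Label) (r r' : S.Role) (x : RoleTerm S)
  | claim (ℓ : S.Label) (r : S.Role) (cl : ClaimName) (arg : Option (RoleTerm S))
  | finish (ℓ : S.Label) (r : S.Role)

/-- An event list together with a (partial) typing of identifiers. -/
structure RoleSpec where
  events : List (Event S)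
  type : S.Ident → Option IdentType

/-- A partial map from role names to role specifications. -/
abbrev Protocol := S.Role → Option (RoleSpec S)

/-- The values of variables and parameters are restricted to nonce run terms. -/
structure Instantiation where
  rid : S.RunId
  agents : S.Role → Option S.Agent
  values : S.Ident → Option (Nonce S)

/-- A run: an instantiation and the list of the events that remain to be executed. -/
abbrev Run := Instantiation S × List (Event S)

abbrev RunEvent := Instantiation S × Event S

abbrev Trace := List (RunEvent S)

end Syntax_

variable {S : Signature}

/-! ### Terms and events -/

/-- The identifiers that appear in a role term. -/
def RoleTerm.idents : RoleTerm S → Set S.Ident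
  | .ident x => {x}
  | .role _ => ∅
  | .app _ _ xs => ⋃ i, (xs i).idents
  | .pair x y => x.idents ∪ y.idents
  | .enc x y => x.idents ∪ y.idents

open Classical in
/-- `x.subst c d` is `x[c/d]`: every occurrence of the identifier `d` is replaced by `c`. -/
noncomputable def RoleTerm.subst (c d : S.Ident) : RoleTerm S → RoleTerm S
  | .ident x => .ident (if x = d then c else x)
  | .role r => .role r
  | .app f n xs => .app f n fun i => (xs i).subst c d
  | .pair x y => .pair (x.subst c d) (y.subst c d)
  | .enc x y => .enc (x.subst c d) (y.subst c d)

/-- The inverse key; every term that is not of the form `f(…)` is a symmetric key. -/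
def RunTerm.inv : RunTerm S → RunTerm S
  | .app f n ts => .app (S.inv f) n ts
  | t => t

/-- No term of the form `c ♯ rid` occurs in the run term, not even in a function argument. -/
def RunTerm.NoFresh : RunTerm S → Prop
  | .agent _ => True
  | .nonce (.fresh _ _) => False
  | .nonce (.intruder _) => True
  | .app _ _ ts => ∀ i, (ts i).NoFresh
  | .pair t u => t.NoFresh ∧ u.NoFresh
  | .enc t u => t.NoFresh ∧ u.NoFresh

def Event.label : Event S → S.Label
  | .create ℓ _ => ℓ
  | .send ℓ _ _ _ => ℓ
  | .read ℓ _ _ _ => ℓ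
  | .claim ℓ _ _ _ => ℓ
  | .finish ℓ _ => ℓ

/-- The identifiers that appear in an event. -/
def Event.idents : Event S → Set S.Ident
  | .send _ _ _ x => x.idents
  | .read _ _ _ x => x.idents
  | .claim _ _ _ (some x) => x.idents
  | _ => ∅

/-- Replacement of the identifier `d` by `c` in an event. -/
noncomputable def Event.subst (c d : S.Ident) : Event S → Event S
  | .create ℓ r => .create ℓ r
  | .send ℓ r r' x => .send ℓ r r' (x.subst c d)
  | .read ℓ r r' x => .read ℓ r r' (x.subst c d)
  | .claim ℓ r cl arg => .claim ℓ r cl (arg.map (RoleTerm.subst c d))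
  | .finish ℓ r => .finish ℓ r

/-- Change of the label of an event. -/
def Event.relabel (lam : S.Label → S.Label) : Event S → Event S
  | .create ℓ r => .create (lam ℓ) r
  | .send ℓ r r' x => .send (lam ℓ) r r' x
  | .read ℓ r r' x => .read (lam ℓ) r r' x
  | .claim ℓ r cl arg => .claim (lam ℓ) r cl arg
  | .finish ℓ r => .finish (lam ℓ) r

/-- The events of the role `r` other than create and finish events. -/
def Event.IsInner (r : S.Role) : Event S → Prop
  | .send _ a _ _ => a = r
  | .read _ _ b _ => b = r
  | .claim _ a _ _ => a = r
  | _ => False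

/-- A send and a read event with the same label, sender and recipient. -/
def Event.Corresponding (e e' : Event S) : Prop :=
  ∃ ℓ a b x y, (e = .send ℓ a b x ∧ e' = .read ℓ a b y) ∨ (e = .read ℓ a b y ∧ e' = .send ℓ a b x)

/-! ### Role specifications, protocols, protocol sets -/

/-- The event list starts with the only create event and terminates with the only finish event, all
events belong to the role `r`, and all identifiers that appear in the list have a type. -/
structure RoleSpec.WellFormed (rs : RoleSpec S) (r : S.Role) : Prop where
  shape : ∃ ℓ ℓ' inner, rs.events = .create ℓ r :: (inner ++ [.finish ℓ' r]) ∧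
    ∀ e ∈ inner, e.IsInner r
  typed : ∀ e ∈ rs.events, ∀ x ∈ e.idents, (rs.type x).isSome

/-- The roles of a protocol. -/
def Protocol.dom (P : Protocol S) : Set S.Role := {r | (P r).isSome}

def Protocol.labels (P : Protocol S) : Set S.Label :=
  {ℓ | ∃ r rs, P r = some rs ∧ ∃ e ∈ rs.events, e.label = ℓ}

/-- The identifiers of a protocol: those that have a type in one of its role specifications (for a
well-formed protocol these include all identifiers that appear in its events). -/
def Protocol.idents (P : Protocol S) : Set S.Ident :=
  {x | ∃ r rs, P r = some rs ∧ (rs.type x).isSome}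

/-- All role specifications are well-formed, and labels are unique except that corresponding send
and read events share their label. -/
structure Protocol.WellFormed (P : Protocol S) : Prop where
  roles : ∀ r rs, P r = some rs → rs.WellFormed r
  labels_unique : ∀ (r : S.Role) (rs : RoleSpec S) (i : ℕ) (e : Event S)
    (r' : S.Role) (rs' : RoleSpec S) (i' : ℕ) (e' : Event S),
    P r = some rs → rs.events[i]? = some e → P r' = some rs' → rs'.events[i']? = some e' →
    e.label = e'.label → (r = r' ∧ i = i') ∨ e.Corresponding e'

/-- A set of protocols in which every label is used in at most one protocol. -/
structure IsProtocolSet (Prots : Set (Protocol S)) : Prop where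
  wellFormed : ∀ P ∈ Prots, Protocol.WellFormed P
  labels_disjoint : ∀ P ∈ Prots, ∀ Q ∈ Prots, P ≠ Q →
    Disjoint (Protocol.labels P) (Protocol.labels Q)

/-- `ℓ ∈ Prots`: the label is used in a protocol of the set. -/
def LabelIn (ℓ : S.Label) (Prots : Set (Protocol S)) : Prop :=
  ∃ P ∈ Prots, ℓ ∈ Protocol.labels P

/-! ### Instantiation -/

/-- `Evaluates ty ι x t` says that `ι(x)` is defined and equal to `t`, where `ty` is the typing of
the role specification that serves as context. -/
inductive Evaluates (ty : S.Ident → Option IdentType) (ι : Instantiation S) :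
    RoleTerm S → RunTerm S → Prop
  | role {r : S.Role} {a : S.Agent} (h : ι.agents r = some a) :
      Evaluates ty ι (.role r) (.agent a)
  | const {x : S.Ident} (h : ty x = some .const) :
      Evaluates ty ι (.ident x) (.nonce (.fresh x ι.rid))
  | value {x : S.Ident} {n : Nonce S} (h : ty x = some .param ∨ ty x = some .var)
      (hn : ι.values x = some n) : Evaluates ty ι (.ident x) (.nonce n)
  | app {f : S.Func} {n : ℕ} {xs : Fin n → RoleTerm S} {ts : Fin n → RunTerm S}
      (h : ∀ i, Evaluates ty ι (xs i) (ts i)) : Evaluates ty ι (.app f n xs) (.app f n ts)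
  | pair {x y : RoleTerm S} {t u : RunTerm S} (hx : Evaluates ty ι x t) (hy : Evaluates ty ι y u) :
      Evaluates ty ι (.pair x y) (.pair t u)
  | enc {x y : RoleTerm S} {t u : RunTerm S} (hx : Evaluates ty ι x t) (hy : Evaluates ty ι y u) :
      Evaluates ty ι (.enc x y) (.enc t u)

/-- `rs` is a role specification of the protocol set that contains the event `ev`. In a protocol
set it is determined by `ev`. -/
def IsContext (Prots : Set (Protocol S)) (ev : Event S) (rs : RoleSpec S) : Prop :=
  ∃ P ∈ Prots, ∃ r, P r = some rs ∧ ev ∈ rs.events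

/-- `inst(x) = t` for a run event `(inst, ev)`, in the context of the role specification
determined by `ev`. -/
def Denotes (Prots : Set (Protocol S)) (e : RunEvent S) (x : RoleTerm S) (t : RunTerm S) : Prop :=
  ∃ rs, IsContext Prots e.2 rs ∧ Evaluates rs.type e.1 x t

/-- The match predicate: `ι'` extends `ι` by values for the free variables of `m`, in such a way
that `m` becomes `t`. -/
structure Matches (ty : S.Ident → Option IdentType) (ι : Instantiation S) (m : RoleTerm S)
    (t : RunTerm S) (ι' : Instantiation S) : Prop where
  rid : ι'.rid = ι.rid
  agents : ι'.agents = ι.agents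
  extend : ∀ x n, ι.values x = some n → ι'.values x = some n
  domain : {x | (ι'.values x).isSome} =
    {x | (ι.values x).isSome} ∪ {x | x ∈ m.idents ∧ ty x = some .var}
  eval : Evaluates ty ι' m t

/-- `(ι, el)` is an initial run of some role of a protocol in the set. -/
def IsInitialRun (Prots : Set (Protocol S)) (run : Run S) : Prop :=
  ∃ P ∈ Prots, ∃ r rs, P r = some rs ∧ run.2 = rs.events ∧
    {r' | (run.1.agents r').isSome} = Protocol.dom P ∧
    {x | (run.1.values x).isSome} = {x | rs.type x = some .param}

/-! ### The intruder and the transition system -/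

/-- The closure of a set of run terms under the Dolev–Yao rules. -/
inductive Closure (K : Set (RunTerm S)) : RunTerm S → Prop
  | base {t : RunTerm S} (h : t ∈ K) : Closure K t
  | pair {t u : RunTerm S} (ht : Closure K t) (hu : Closure K u) : Closure K (.pair t u)
  | fst {t u : RunTerm S} (h : Closure K (.pair t u)) : Closure K t
  | snd {t u : RunTerm S} (h : Closure K (.pair t u)) : Closure K u
  | enc {t u : RunTerm S} (ht : Closure K t) (hu : Closure K u) : Closure K (.enc t u)
  | dec {t u : RunTerm S} (h : Closure K (.enc t u)) (hu : Closure K u.inv) : Closure K t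

/-- The initial intruder knowledge determined by a protocol set. It contains the
intruder-generated terms, and no constant of a run occurs in it. -/
structure InitialKnowledge (S : Signature) where
  terms : Set (Protocol S) → Set (RunTerm S)
  intruder_mem : ∀ Prots i, RunTerm.nonce (.intruder i) ∈ terms Prots
  noFresh : ∀ Prots, ∀ t ∈ terms Prots, t.NoFresh

/-- A system state: the intruder knowledge and the set of active runs. -/
structure State (S : Signature) where
  knowledge : Set (RunTerm S)
  runs : Set (Run S)

/-- `F[new/old]`. -/
def replaceRun (F : Set (Run S)) (new old : Run S) : Set (Run S) := (F \ {old}) ∪ {new}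

/-- The transition relation of the system that executes a protocol set. -/
inductive Step (Prots : Set (Protocol S)) : State S → RunEvent S → State S → Prop
  | create {K : Set (RunTerm S)} {F : Set (Run S)} {ι : Instantiation S} {ℓ : S.Label}
      {r : S.Role} {el : List (Event S)} (h : IsInitialRun Prots (ι, .create ℓ r :: el))
      (hrid : ∀ run ∈ F, run.1.rid ≠ ι.rid) :
      Step Prots ⟨K, F⟩ (ι, .create ℓ r) ⟨K, F ∪ {(ι, el)}⟩
  | finish {K : Set (RunTerm S)} {F : Set (Run S)} {ι : Instantiation S} {ℓ : S.Label}
      {r : S.Role} (h : (ι, [.finish ℓ r]) ∈ F) :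
      Step Prots ⟨K, F⟩ (ι, .finish ℓ r) ⟨K, replaceRun F (ι, []) (ι, [.finish ℓ r])⟩
  | send {K : Set (RunTerm S)} {F : Set (Run S)} {ι : Instantiation S} {ℓ : S.Label}
      {r r' : S.Role} {m : RoleTerm S} {el : List (Event S)} {t : RunTerm S}
      (h : (ι, .send ℓ r r' m :: el) ∈ F) (ht : Denotes Prots (ι, .send ℓ r r' m) m t) :
      Step Prots ⟨K, F⟩ (ι, .send ℓ r r' m)
        ⟨{u | Closure (K ∪ {t}) u}, replaceRun F (ι, el) (ι, .send ℓ r r' m :: el)⟩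
  | read {K : Set (RunTerm S)} {F : Set (Run S)} {ι ι' : Instantiation S} {ℓ : S.Label}
      {r r' : S.Role} {m : RoleTerm S} {el : List (Event S)} {t : RunTerm S} {rs : RoleSpec S}
      (h : (ι, .read ℓ r r' m :: el) ∈ F) (ht : t ∈ K)
      (hrs : IsContext Prots (.read ℓ r r' m) rs) (hm : Matches rs.type ι m t ι') :
      Step Prots ⟨K, F⟩ (ι', .read ℓ r r' m)
        ⟨K, replaceRun F (ι', el) (ι, .read ℓ r r' m :: el)⟩
  | claim {K : Set (RunTerm S)} {F : Set (Run S)} {ι : Instantiation S} {ℓ : S.Label}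
      {r : S.Role} {cl : ClaimName} {arg : Option (RoleTerm S)} {el : List (Event S)}
      (h : (ι, .claim ℓ r cl arg :: el) ∈ F) :
      Step Prots ⟨K, F⟩ (ι, .claim ℓ r cl arg)
        ⟨K, replaceRun F (ι, el) (ι, .claim ℓ r cl arg :: el)⟩

/-- `Derives K Prots α s`: the trace `α` leads from the initial state to the state `s`. -/
inductive Derives (K : InitialKnowledge S) (Prots : Set (Protocol S)) : Trace S → State S → Prop
  | nil : Derives K Prots [] ⟨{t | Closure (K.terms Prots) t}, ∅⟩
  | snoc {α : Trace S} {e : RunEvent S} {s s' : State S} (h : Derives K Prots α s)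
      (hs : Step Prots s e s') : Derives K Prots (α ++ [e]) s'

/-- The valid traces of a protocol set. -/
def traces (K : InitialKnowledge S) (Prots : Set (Protocol S)) : Set (Trace S) :=
  {α | ∃ s, Derives K Prots α s}

/-- The intruder knowledge after the execution of the whole trace. -/
def finalKnowledge (K : InitialKnowledge S) (Prots : Set (Protocol S)) (α : Trace S) :
    Set (RunTerm S) :=
  {t | ∃ s, Derives K Prots α s ∧ t ∈ s.knowledge}

/-! ### Establishing an identifier and the trace restriction for unique input -/

/-- `P` establishes `c`: whenever a run of `P` stops, in any trace of any protocol set that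
contains `P`, its instantiation is defined at `c`. -/
def Establishes (K : InitialKnowledge S) (P : Protocol S) (c : S.Ident) : Prop :=
  ∀ Prots : Set (Protocol S), IsProtocolSet Prots → P ∈ Prots → ∀ α ∈ traces K Prots,
    ∀ ι ℓ r, (ι, Event.finish ℓ r) ∈ α → ℓ ∈ Protocol.labels P →
      ∃ t, Denotes Prots (ι, .finish ℓ r) (.ident c) t

/-- For a create event `(ι, create(r))` at position `i`: the positions of the create events in
`Cons` for the same role, with the same agents and the same value of the input `d`. -/
def sameInput (Prots Cons : Set (Protocol S)) (d : S.Ident) (α : Trace S) (i : ℕ) : Set ℕ :=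
  {j | ∃ ι ℓ r ι' ℓ' t, α[i]? = some (ι, .create ℓ r) ∧ α[j]? = some (ι', .create ℓ' r) ∧
    LabelIn ℓ' Cons ∧ ι'.agents = ι.agents ∧
    Denotes Prots (ι, .create ℓ r) (.ident d) t ∧ Denotes Prots (ι', .create ℓ' r) (.ident d) t}

/-- For a create event `(ι, create(r))` at position `i`: the positions of the finish events in `Prod`
for the same role, with the same agents, whose value of `c` is the value of the input `d`. -/
def sources (Prots Prod : Set (Protocol S)) (c d : S.Ident) (α : Trace S) (i : ℕ) : Set ℕ :=
  {j | ∃ ι ℓ r ι' ℓ' t, α[i]? = some (ι, .create ℓ r) ∧ α[j]? = some (ι', .finish ℓ' r) ∧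
    LabelIn ℓ' Prod ∧ ι'.agents = ι.agents ∧
    Denotes Prots (ι, .create ℓ r) (.ident d) t ∧ Denotes Prots (ι', .finish ℓ' r) (.ident c) t}

/-- The trace restriction: every run of a role of a protocol in `Cons` takes its input `d` from the
value of `c` in an earlier completed run of the same role, with the same agents, of a protocol in
`Prod`, and each such completed run supplies the input of at most one run. -/
def UniqueInput (Prots Prod Cons : Set (Protocol S)) (c d : S.Ident) (α : Trace S) : Prop :=
  ∀ i ι ℓ r, α[i]? = some (ι, Event.create ℓ r) → LabelIn ℓ Cons →
    ∃ f : sameInput Prots Cons d α i → sources Prots Prod c d α i,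
      Function.Injective f ∧ ∀ j, (f j : ℕ) < (j : ℕ)

/-! ### Security properties -/

abbrev SecurityProperty (S : Signature) :=
  Set (Protocol S) → Event S → Instantiation S → Trace S → Prop

/-- Satisfaction of the claims of kind `cl` with label `ℓ`, whose meaning is `f`, in all traces
that fulfil the restriction `χ`; only runs between trusted agents count. -/
def Satisfies (K : InitialKnowledge S) (cl : ClaimName) (f : SecurityProperty S)
    (Prots : Set (Protocol S)) (χ : Trace S → Prop) (ℓ : S.Label) : Prop :=
  ∀ α ∈ traces K Prots, χ α → ∀ ι r arg, (ι, Event.claim ℓ r cl arg) ∈ α →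
    f Prots (.claim ℓ r cl arg) ι α ∨ ∃ r' a, ι.agents r' = some a ∧ a ∉ S.trusted

/-- Secrecy: the intruder does not learn the claimed term in the trace. -/
def secrecy (K : InitialKnowledge S) : SecurityProperty S := fun Prots ev ι α =>
  ∀ ℓ r m, ev = .claim ℓ r .secret (some m) →
    ∀ t, Denotes Prots (ι, ev) m t → t ∉ finalKnowledge K Prots α

/-- `ℓ` is the label of a secrecy claim event in the protocol. -/
def IsSecretLabel (P : Protocol S) (ℓ : S.Label) : Prop :=
  ∃ r rs m, P r = some rs ∧ Event.claim ℓ r .secret (some m) ∈ rs.events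

/-! ### Chaining composition -/

open Classical in
/-- Replacement of the identifier `d` by `c` in a role specification. -/
noncomputable def RoleSpec.subst (rs : RoleSpec S) (c d : S.Ident) : RoleSpec S where
  events := rs.events.map (Event.subst c d)
  type x := if x = c then rs.type d else if x = d then none else rs.type x

/-- Sequential composition of role specifications: the finish event of the first and the create event
of the second one are dropped. -/
def RoleSpec.seq (rs₁ rs₂ : RoleSpec S) : RoleSpec S where
  events := rs₁.events.dropLast ++ rs₂.events.tail
  type x := (rs₁.type x).or (rs₂.type x)

def RoleSpec.relabel (rs : RoleSpec S) (lam : S.Label → S.Label) : RoleSpec S where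
  events := rs.events.map (Event.relabel lam)
  type := rs.type

/-- The chaining composition, `r ↦ P(r) · Q(r)[c/d]`, with the events relabelled by `lam`. -/
noncomputable def chain (lam : S.Label → S.Label) (P Q : Protocol S) (c d : S.Ident) :
    Protocol S := fun r =>
  match P r, Q r with
  | some rs₁, some rs₂ => some ((rs₁.seq (rs₂.subst c d)).relabel lam)
  | _, _ => none

/-- The conditions under which the chaining composition is defined. -/
structure ChainDefined (K : InitialKnowledge S) (P Q : Protocol S) (c d : S.Ident) : Prop where
  dom_eq : Protocol.dom P = Protocol.dom Q
  idents_disjoint : Disjoint (Protocol.idents P) (Protocol.idents Q)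
  establishes : Establishes K P c
  param : ∀ r rs, Q r = some rs → rs.type d = some .param

end SecProt

/-! An attack on a secrecy claim of the composition is turned into an attack on the claim of `P` or
`Q` it came from, by a step-by-step simulation. Given a trace of the composed system, every run of
`P·Q` is cut in two: a run of `P` and a run of `Q`, with different run identifiers. Since the set of
run identifiers is infinite, it contains two disjoint injective copies of itself, given by `fst` and
`snd`. A composed run `rid` becomes the `P`-run `fst rid` and the `Q`-run `snd rid`; a run of a
protocol in `Prots` gets the identifier `fst rid`.

Run terms are renamed accordingly. As `P` and `Q` share no identifier, a constant created by a
composed run belongs to the `Q`-run exactly if its identifier is one of `Q`, so the renaming depends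
on both constant and run. It is a homomorphism that commutes with inverse keys and fixes the initial
knowledge, hence it carries intruder derivations to intruder derivations (`Closure.rename`). Renamed
terms known in the composed system therefore stay known in the simulating one, and every read and
send can be repeated there (`Translates.executes`). The converse inclusion is not needed, because
attacks are transferred in one direction only.

The one delicate point is the passage from `P` to `Q`. When a composed run is about to execute its
first event of `Q`, and not before, the simulating system inserts two steps: the `P`-run ends and
the `Q`-run is created (`exists_simulates_secondSim`). That `P` establishes `c` supplies the input
for `d`. As the end event immediately precedes the create event, the predecessor map on positions is
an injective choice of sources, so the simulating trace satisfies the unique-input restriction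
(`InputChained.uniqueInput`).

Finally, each secrecy claim of the composition has a counterpart in the simulating trace with the
same agents and the renamed term (`ClaimsMatch`), so a leaked term leaks there too. -/

namespace SecProt

variable {S : Signature}

/-! ### Renaming of run identifiers in run terms -/

/-- Renaming of the run identifiers of the run constants; it may depend on the constant. -/
def Nonce.rename (ν : S.Ident → S.RunId → S.RunId) : Nonce S → Nonce S
  | .fresh x rid => .fresh x (ν x rid)
  | .intruder i => .intruder i

def RunTerm.rename (ν : S.Ident → S.RunId → S.RunId) : RunTerm S → RunTerm S
  | .agent a => .agent a
  | .nonce n => .nonce (n.rename ν)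
  | .app f n ts => .app f n fun i => (ts i).rename ν
  | .pair t u => .pair (t.rename ν) (u.rename ν)
  | .enc t u => .enc (t.rename ν) (u.rename ν)

theorem RunTerm.rename_inv (ν : S.Ident → S.RunId → S.RunId) (t : RunTerm S) :
    t.inv.rename ν = (t.rename ν).inv := by
  cases t <;> rfl

theorem RunTerm.NoFresh.rename_eq (ν : S.Ident → S.RunId → S.RunId) {t : RunTerm S}
    (h : t.NoFresh) : t.rename ν = t := by
  induction t with
  | agent a => rfl
  | nonce n =>
    cases n with
    | fresh c rid => exact h.elim
    | intruder i => rfl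
  | app f n ts ih =>
    simp only [RunTerm.rename]
    congr 1
    funext i
    exact ih i (h i)
  | pair t u iht ihu => simp only [RunTerm.rename, iht h.1, ihu h.2]
  | enc t u iht ihu => simp only [RunTerm.rename, iht h.1, ihu h.2]

/-- Renaming is a homomorphism that respects inverse keys, so each Dolev–Yao rule maps to an
instance of itself. No injectivity is needed: identifying terms can only help the intruder. -/
theorem Closure.rename (ν : S.Ident → S.RunId → S.RunId) {K K' : Set (RunTerm S)}
    (hK : ∀ t ∈ K, Closure K' (t.rename ν)) {t : RunTerm S} (h : Closure K t) :
    Closure K' (t.rename ν) := by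
  induction h with
  | base h => exact hK _ h
  | pair _ _ iht ihu => exact .pair iht ihu
  | fst _ ih => exact .fst ih
  | snd _ ih => exact .snd ih
  | enc _ _ iht ihu => exact .enc iht ihu
  | dec _ _ iht ihu => exact .dec iht (by rwa [← RunTerm.rename_inv])

/-! ### Contexts of events -/

theorem Protocol.mem_labels {P : Protocol S} {r : S.Role} {rs : RoleSpec S} {e : Event S}
    (hr : P r = some rs) (he : e ∈ rs.events) : e.label ∈ P.labels :=
  ⟨r, rs, hr, e, he, rfl⟩

theorem Protocol.mem_idents {P : Protocol S} {r : S.Role} {rs : RoleSpec S} {x : S.Ident}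
    (hr : P r = some rs) (hx : (rs.type x).isSome) : x ∈ P.idents :=
  ⟨r, rs, hr, hx⟩

theorem IsProtocolSet.eq_of_label {Prots : Set (Protocol S)} (h : IsProtocolSet Prots)
    {P Q : Protocol S} (hP : P ∈ Prots) (hQ : Q ∈ Prots) {ℓ : S.Label} (hℓP : ℓ ∈ P.labels)
    (hℓQ : ℓ ∈ Q.labels) : P = Q := by
  by_contra hne
  exact Set.disjoint_left.mp (h.labels_disjoint P hP Q hQ hne) hℓP hℓQ

theorem Event.not_corresponding_self (e : Event S) : ¬ e.Corresponding e := by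
  rintro ⟨ℓ, a, b, x, y, ⟨h, h'⟩ | ⟨h, h'⟩⟩ <;> rw [h] at h' <;> cases h'

/-- A label fixes the protocol, and within it an event up to a corresponding send/read partner; an
event is never its own partner. -/
theorem IsProtocolSet.context_unique {Prots : Set (Protocol S)} (h : IsProtocolSet Prots)
    {ev : Event S} {rs rs' : RoleSpec S} (h₁ : IsContext Prots ev rs)
    (h₂ : IsContext Prots ev rs') : rs = rs' := by
  obtain ⟨P, hP, r, hr, he⟩ := h₁
  obtain ⟨Q, hQ, r', hr', he'⟩ := h₂
  obtain rfl := h.eq_of_label hP hQ (Protocol.mem_labels hr he) (Protocol.mem_labels hr' he')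
  obtain ⟨i, hi⟩ := List.mem_iff_getElem?.mp he
  obtain ⟨j, hj⟩ := List.mem_iff_getElem?.mp he'
  obtain ⟨rfl, -⟩ | hc := (h.wellFormed P hP).labels_unique r rs i ev r' rs' j ev hr hi hr' hj rfl
  · exact Option.some.inj (hr.symm.trans hr')
  · exact (ev.not_corresponding_self hc).elim

theorem RoleSpec.WellFormed.ne_finish {rs : RoleSpec S} {r : S.Role} (h : rs.WellFormed r)
    {e : Event S} (he : e ∈ rs.events.dropLast) (ℓ : S.Label) (r' : S.Role) :
    e ≠ .finish ℓ r' := by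
  obtain ⟨ℓ₁, ℓ₂, inner, hev, hin⟩ := h.shape
  rw [hev, ← List.cons_append, List.dropLast_concat] at he
  rintro rfl
  obtain _ | ⟨_, he⟩ := he
  exact hin _ he

/-! ### Execution of a single event of a run -/

/-- The effect of the execution of an event other than a create event on the intruder knowledge and
on the instantiation of the run. -/
inductive Executes (Prots : Set (Protocol S)) :
    Set (RunTerm S) → Instantiation S → Event S → Set (RunTerm S) → Instantiation S → Prop
  | finish {K : Set (RunTerm S)} {ι : Instantiation S} {ℓ : S.Label} {r : S.Role} :
      Executes Prots K ι (.finish ℓ r) K ι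
  | claim {K : Set (RunTerm S)} {ι : Instantiation S} {ℓ : S.Label} {r : S.Role} {cl : ClaimName}
      {arg : Option (RoleTerm S)} : Executes Prots K ι (.claim ℓ r cl arg) K ι
  | send {K : Set (RunTerm S)} {ι : Instantiation S} {ℓ : S.Label} {r r' : S.Role}
      {m : RoleTerm S} {t : RunTerm S} (ht : Denotes Prots (ι, .send ℓ r r' m) m t) :
      Executes Prots K ι (.send ℓ r r' m) {u | Closure (K ∪ {t}) u} ι
  | read {K : Set (RunTerm S)} {ι ι' : Instantiation S} {ℓ : S.Label} {r r' : S.Role}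
      {m : RoleTerm S} {t : RunTerm S} {rs : RoleSpec S} (ht : t ∈ K)
      (hrs : IsContext Prots (.read ℓ r r' m) rs) (hm : Matches rs.type ι m t ι') :
      Executes Prots K ι (.read ℓ r r' m) K ι'

theorem Executes.rid {Prots : Set (Protocol S)} {K K' : Set (RunTerm S)} {ι ι' : Instantiation S}
    {e : Event S} (h : Executes Prots K ι e K' ι') : ι'.rid = ι.rid := by
  cases h with
  | read _ _ hm => exact hm.rid
  | _ => rfl

theorem Executes.ne_create {Prots : Set (Protocol S)} {K K' : Set (RunTerm S)}
    {ι ι' : Instantiation S} {e : Event S} (h : Executes Prots K ι e K' ι') (ℓ : S.Label)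
    (r : S.Role) : e ≠ .create ℓ r := by
  rintro rfl
  cases h

/-- The condition on `el` is there because the transition rule for finish events applies only to the
last event of a run. -/
theorem Executes.step {Prots : Set (Protocol S)} {K K' : Set (RunTerm S)} {ι ι' : Instantiation S}
    {e : Event S} (h : Executes Prots K ι e K' ι') {F : Set (Run S)} {el : List (Event S)}
    (hF : (ι, e :: el) ∈ F) (hel : ∀ ℓ r, e = .finish ℓ r → el = []) :
    Step Prots ⟨K, F⟩ (ι', e) ⟨K', replaceRun F (ι', el) (ι, e :: el)⟩ := by
  cases h with
  | finish =>
    obtain rfl := hel _ _ rfl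
    exact .finish hF
  | claim => exact .claim hF
  | send ht => exact .send hF ht
  | read ht hrs hm => exact .read hF ht hrs hm

/-- A step either creates a run or executes an event of an active run. -/
theorem Step.create_or_executes {Prots : Set (Protocol S)} {s s' : State S} {e : RunEvent S}
    (h : Step Prots s e s') :
    (∃ ℓ r el, e.2 = .create ℓ r ∧ IsInitialRun Prots (e.1, .create ℓ r :: el) ∧
      (∀ run ∈ s.runs, run.1.rid ≠ e.1.rid) ∧ s'.knowledge = s.knowledge ∧
      s'.runs = s.runs ∪ {(e.1, el)}) ∨
    ∃ ι el, (ι, e.2 :: el) ∈ s.runs ∧ (∀ ℓ r, e.2 = .finish ℓ r → el = []) ∧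
      Executes Prots s.knowledge ι e.2 s'.knowledge e.1 ∧
      s'.runs = replaceRun s.runs (e.1, el) (ι, e.2 :: el) := by
  cases h with
  | create h hrid => exact .inl ⟨_, _, _, rfl, h, hrid, rfl, rfl⟩
  | finish h => exact .inr ⟨_, _, h, fun _ _ _ => rfl, .finish, rfl⟩
  | send h ht => exact .inr ⟨_, _, h, by simp, .send ht, rfl⟩
  | read h ht hrs hm => exact .inr ⟨_, _, h, by simp, .read ht hrs hm, rfl⟩
  | claim h => exact .inr ⟨_, _, h, by simp, .claim, rfl⟩

/-! ### Run identifiers in reachable states -/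

theorem mem_replaceRun {F : Set (Run S)} {new old run : Run S} :
    run ∈ replaceRun F new old ↔ (run ∈ F ∧ run ≠ old) ∨ run = new := by
  simp [replaceRun, or_comm]

theorem mem_replaceRun_of_rid_ne {F : Set (Run S)} {new old run : Run S}
    (hold : run.1.rid ≠ old.1.rid) (hnew : run.1.rid ≠ new.1.rid) :
    run ∈ replaceRun F new old ↔ run ∈ F := by
  rw [mem_replaceRun]
  constructor
  · rintro (⟨h, -⟩ | rfl)
    · exact h
    · exact (hnew rfl).elim
  · exact fun h => .inl ⟨h, fun h => hold (h ▸ rfl)⟩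

/-- Different active runs have different run identifiers. -/
theorem Derives.runs_injOn {K : InitialKnowledge S} {Prots : Set (Protocol S)} {α : Trace S}
    {s : State S} (h : Derives K Prots α s) : Set.InjOn (fun run : Run S => run.1.rid) s.runs := by
  induction h with
  | nil => simp
  | snoc h hs ih =>
    obtain ⟨ℓ, r, el, -, -, hrid, -, hF⟩ | ⟨ι, el, hF, -, he, hF'⟩ := hs.create_or_executes
    · rw [hF]
      rintro a (ha | rfl) b (hb | rfl) hab
      · exact ih ha hb hab
      · exact (hrid a ha hab).elim
      · exact (hrid b hb hab.symm).elim
      · rfl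
    · rw [hF']
      intro a ha b hb hab
      obtain ⟨ha, ha'⟩ | rfl := mem_replaceRun.mp ha <;>
        obtain ⟨hb, hb'⟩ | rfl := mem_replaceRun.mp hb
      · exact ih ha hb hab
      · exact (ha' (ih ha hF (hab.trans he.rid))).elim
      · exact (hb' (ih hb hF (hab.symm.trans he.rid))).elim
      · rfl

/-- Runs never leave the state: a completed run stays with an empty event list, so its identifier
remains used. -/
theorem Derives.exists_run_of_create {K : InitialKnowledge S} {Prots : Set (Protocol S)}
    {α : Trace S} {s : State S} (h : Derives K Prots α s) {ι : Instantiation S} {ℓ : S.Label}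
    {r : S.Role} (hmem : (ι, Event.create ℓ r) ∈ α) : ∃ run ∈ s.runs, run.1.rid = ι.rid := by
  induction h with
  | nil => simp at hmem
  | @snoc α e s s' h hs ih =>
    have hs' := hs.create_or_executes
    rw [List.mem_append, List.mem_singleton] at hmem
    obtain ⟨ℓ, r, el, -, -, hrid, -, hF⟩ | ⟨ι', el, hF, -, he, hF'⟩ := hs'
    · rw [hF]
      obtain hmem | rfl := hmem
      · obtain ⟨run, hrun, h⟩ := ih hmem
        exact ⟨run, .inl hrun, h⟩
      · exact ⟨_, .inr rfl, rfl⟩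
    · obtain hmem | rfl := hmem
      · obtain ⟨run, hrun, h⟩ := ih hmem
        rw [hF']
        by_cases hr : run = (ι', e.2 :: el)
        · exact ⟨_, mem_replaceRun.mpr (.inr rfl), by rw [← h, hr]; exact he.rid⟩
        · exact ⟨run, mem_replaceRun.mpr (.inl ⟨hrun, hr⟩), h⟩
      · exact (he.ne_create _ _ rfl).elim

/-- A run identifier is used in at most one create event. -/
theorem Derives.create_unique {K : InitialKnowledge S} {Prots : Set (Protocol S)} {α : Trace S}
    {s : State S} (h : Derives K Prots α s) {ι ι' : Instantiation S} {ℓ ℓ' : S.Label}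
    {r r' : S.Role} (h₁ : (ι, Event.create ℓ r) ∈ α) (h₂ : (ι', Event.create ℓ' r') ∈ α)
    (hrid : ι.rid = ι'.rid) : ℓ = ℓ' := by
  induction h with
  | nil => simp at h₁
  | @snoc α e s s' h hs ih =>
    have hs' := hs.create_or_executes
    rw [List.mem_append, List.mem_singleton] at h₁ h₂
    have key : ∀ {ι₁ : Instantiation S} {ℓ₁ r₁ ι₂ ℓ₂ r₂}, (ι₁, Event.create ℓ₁ r₁) ∈ α →
        (ι₂, Event.create ℓ₂ r₂) = e → ι₁.rid = ι₂.rid → False := by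
      rintro ι₁ ℓ₁ r₁ ι₂ ℓ₂ r₂ hm rfl hr
      obtain ⟨run, hrun, hrr⟩ := h.exists_run_of_create hm
      obtain ⟨_, _, _, -, -, hn, -⟩ | ⟨_, _, -, -, he, -⟩ := hs'
      · exact hn run hrun (hrr.trans hr)
      · exact he.ne_create _ _ rfl
    obtain h₁ | h₁ := h₁ <;> obtain h₂ | h₂ := h₂
    · exact ih h₁ h₂
    · exact (key h₁ h₂ hrid).elim
    · exact (key h₂ h₁ hrid.symm).elim
    · injection (h₁.trans h₂.symm) with _ h
      injection h

/-! ### Transfer of a single execution step between protocol sets -/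

/-- Change of the label and of the terms of an event. -/
def Event.mapTerm (lam : S.Label → S.Label) (f : RoleTerm S → RoleTerm S) : Event S → Event S
  | .create ℓ r => .create (lam ℓ) r
  | .send ℓ r r' x => .send (lam ℓ) r r' (f x)
  | .read ℓ r r' x => .read (lam ℓ) r r' (f x)
  | .claim ℓ r cl arg => .claim (lam ℓ) r cl (arg.map f)
  | .finish ℓ r => .finish (lam ℓ) r

theorem Event.mapTerm_id (e : Event S) : e.mapTerm id id = e := by
  cases e <;> simp [Event.mapTerm]

theorem Event.mapTerm_relabel (lam : S.Label → S.Label) (e : Event S) :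
    e.mapTerm lam id = e.relabel lam := by
  cases e <;> simp [Event.mapTerm, Event.relabel]

theorem Event.mapTerm_subst (lam : S.Label → S.Label) (c d : S.Ident) (e : Event S) :
    e.mapTerm lam (RoleTerm.subst c d) = (e.subst c d).relabel lam := by
  cases e <;> simp [Event.mapTerm, Event.relabel, Event.subst]

theorem Event.label_mapTerm (lam : S.Label → S.Label) (f : RoleTerm S → RoleTerm S) (e : Event S) :
    (e.mapTerm lam f).label = lam e.label := by
  cases e <;> rfl

/-- `T` translates instantiations that fulfil `Ok`, in the typing context `ty`, to instantiations
in the typing context `ty'`; the terms over the identifiers in `X` are replaced along `f`, and the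
run terms are renamed along `ν`. -/
structure Translates (ν : S.Ident → S.RunId → S.RunId) (ty ty' : S.Ident → Option IdentType)
    (X : Set S.Ident) (f : RoleTerm S → RoleTerm S) (Ok : Instantiation S → Prop)
    (T : Instantiation S → Instantiation S) : Prop where
  agents : ∀ ι, (T ι).agents = ι.agents
  eval : ∀ ι x t, Ok ι → x.idents ⊆ X → Evaluates ty ι (f x) t →
    Evaluates ty' (T ι) x (t.rename ν)
  ok : ∀ ι m t ι', Ok ι → m.idents ⊆ X → Matches ty ι (f m) t ι' → Ok ι'
  matches_ : ∀ ι m t ι', Ok ι → m.idents ⊆ X → Matches ty ι (f m) t ι' →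
    Matches ty' (T ι) m (t.rename ν) (T ι')

/-- For a send, the new knowledge is covered by `Closure.rename`; for a read, the renamed message is
already in `K'` and the match is translated along `T`. The other events change neither knowledge nor
instantiation. -/
theorem Translates.executes {ν : S.Ident → S.RunId → S.RunId} {ty : S.Ident → Option IdentType}
    {rs : RoleSpec S} {X : Set S.Ident} {f : RoleTerm S → RoleTerm S} {Ok : Instantiation S → Prop}
    {T : Instantiation S → Instantiation S} (hT : Translates ν ty rs.type X f Ok T)
    {Prots Prots' : Set (Protocol S)} {lam : S.Label → S.Label} {e : Event S} (hX : e.idents ⊆ X)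
    (hty : ∀ rs₀, IsContext Prots (e.mapTerm lam f) rs₀ → rs₀.type = ty)
    (hctx : IsContext Prots' e rs) {K K' K₁ : Set (RunTerm S)} {ι ι₁ : Instantiation S}
    (hok : Ok ι) (hK : ∀ t ∈ K, t.rename ν ∈ K')
    (h : Executes Prots K ι (e.mapTerm lam f) K₁ ι₁) :
    ∃ K₁', Executes Prots' K' (T ι) e K₁' (T ι₁) ∧ (∀ t ∈ K₁, t.rename ν ∈ K₁') ∧ Ok ι₁ := by
  cases e with
  | create ℓ r => exact (h.ne_create _ _ rfl).elim
  | send ℓ r r' m =>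
    cases h with
    | @send _ _ _ _ t ht =>
      obtain ⟨rs₀, hrs₀, hev⟩ := ht
      refine ⟨_, .send ⟨rs, hctx, hT.eval _ _ t hok hX (hty rs₀ hrs₀ ▸ hev)⟩, ?_, hok⟩
      intro u hu
      refine Closure.rename ν ?_ hu
      rintro v (hv | rfl)
      · exact .base (.inl (hK v hv))
      · exact .base (.inr rfl)
  | read ℓ r r' m =>
    cases h with
    | @read _ _ _ _ _ t rs₀ ht hrs hm =>
      rw [hty rs₀ hrs] at hm
      exact ⟨K', .read (hK _ ht) hctx (hT.matches_ _ _ _ _ hok hX hm), hK,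
        hT.ok _ _ _ _ hok hX hm⟩
  | claim ℓ r cl arg =>
    cases h with
    | claim => exact ⟨K', .claim, hK, hok⟩
  | finish ℓ r =>
    cases h with
    | finish => exact ⟨K', .finish, hK, hok⟩

end SecProt

namespace SecProt

variable {S : Signature}

/-! ### Evaluation and renaming -/

theorem evaluates_ident {ty : S.Ident → Option IdentType} {ι : Instantiation S} {x : S.Ident}
    {t : RunTerm S} : Evaluates ty ι (.ident x) t ↔ ∃ n, t = .nonce n ∧
      ((ty x = some .const ∧ n = .fresh x ι.rid) ∨
        ((ty x = some .param ∨ ty x = some .var) ∧ ι.values x = some n)) := by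
  constructor
  · intro h
    cases h with
    | const h => exact ⟨_, rfl, .inl ⟨h, rfl⟩⟩
    | value h hn => exact ⟨_, rfl, .inr ⟨h, hn⟩⟩
  · rintro ⟨n, rfl, ⟨h, rfl⟩ | ⟨h, hn⟩⟩
    · exact .const h
    · exact .value h hn

theorem RoleTerm.mem_idents_subst {c d x : S.Ident} (hc : x ≠ c) (hd : x ≠ d) (m : RoleTerm S) :
    x ∈ (m.subst c d).idents ↔ x ∈ m.idents := by
  induction m with
  | ident y =>
    rw [RoleTerm.subst]
    split_ifs with h
    · subst h
      simp [RoleTerm.idents, hc, hd]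
    · rfl
  | role r => rfl
  | app f n xs ih => simp only [RoleTerm.subst, RoleTerm.idents, Set.mem_iUnion, ih]
  | pair x y hx hy => simp only [RoleTerm.subst, RoleTerm.idents, Set.mem_union, hx, hy]
  | enc x y hx hy => simp only [RoleTerm.subst, RoleTerm.idents, Set.mem_union, hx, hy]

open Classical in
/-- Evaluation commutes with renaming when it does so for the identifiers. -/
theorem Evaluates.rename_of_subst {ν : S.Ident → S.RunId → S.RunId}
    {ty ty' : S.Ident → Option IdentType} {ι ι' : Instantiation S} {c d : S.Ident}
    (hag : ι'.agents = ι.agents) {x : RoleTerm S} {t : RunTerm S}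
    (hid : ∀ y ∈ x.idents, ∀ t, Evaluates ty ι (.ident (if y = d then c else y)) t →
      Evaluates ty' ι' (.ident y) (t.rename ν))
    (h : Evaluates ty ι (x.subst c d) t) : Evaluates ty' ι' x (t.rename ν) := by
  induction x generalizing t with
  | ident y => exact hid y rfl t h
  | role r =>
    cases h with
    | role h => exact .role (hag ▸ h)
  | app f n xs ih =>
    rw [RoleTerm.subst] at h
    cases h with
    | app h => exact .app fun i => ih i (fun y hy => hid y (Set.mem_iUnion.mpr ⟨i, hy⟩)) (h i)
  | pair x y ihx ihy =>
    rw [RoleTerm.subst] at h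
    cases h with
    | pair hx hy =>
      exact .pair (ihx (fun z hz => hid z (.inl hz)) hx) (ihy (fun z hz => hid z (.inr hz)) hy)
  | enc x y ihx ihy =>
    rw [RoleTerm.subst] at h
    cases h with
    | enc hx hy =>
      exact .enc (ihx (fun z hz => hid z (.inl hz)) hx) (ihy (fun z hz => hid z (.inr hz)) hy)

theorem Evaluates.rename {ν : S.Ident → S.RunId → S.RunId}
    {ty ty' : S.Ident → Option IdentType} {ι ι' : Instantiation S}
    (hag : ι'.agents = ι.agents) {x : RoleTerm S} {t : RunTerm S}
    (hid : ∀ y ∈ x.idents, ∀ t, Evaluates ty ι (.ident y) t →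
      Evaluates ty' ι' (.ident y) (t.rename ν))
    (h : Evaluates ty ι x t) : Evaluates ty' ι' x (t.rename ν) := by
  induction x generalizing t with
  | ident y => exact hid y rfl t h
  | role r =>
    cases h with
    | role h => exact .role (hag ▸ h)
  | app f n xs ih =>
    cases h with
    | app h => exact .app fun i => ih i (fun y hy => hid y (Set.mem_iUnion.mpr ⟨i, hy⟩)) (h i)
  | pair x y ihx ihy =>
    cases h with
    | pair hx hy =>
      exact .pair (ihx (fun z hz => hid z (.inl hz)) hx) (ihy (fun z hz => hid z (.inr hz)) hy)
  | enc x y ihx ihy =>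
    cases h with
    | enc hx hy =>
      exact .enc (ihx (fun z hz => hid z (.inl hz)) hx) (ihy (fun z hz => hid z (.inr hz)) hy)

/-! ### Splitting the runs of a chaining composition -/

/-- The runs with identifiers in `composed` are split into two runs: the first one has the
identifier `fst rid`, the second one `snd rid`. The identifiers of all other runs are renamed along
`fst`. -/
structure RunSplit (S : Signature) where
  fst : S.RunId → S.RunId
  snd : S.RunId → S.RunId
  fst_injective : Function.Injective fst
  snd_injective : Function.Injective snd
  fst_ne_snd : ∀ a b, fst a ≠ snd b
  composed : Set S.RunId

/-- An infinite set is equinumerous with the disjoint sum of two copies of itself. -/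
theorem RunSplit.exists_composed_eq (C : Set S.RunId) : ∃ w : RunSplit S, w.composed = C := by
  have := S.runId_infinite
  obtain ⟨e⟩ : Nonempty (S.RunId ⊕ S.RunId ≃ S.RunId) := by
    rw [← Cardinal.eq]
    simp [Cardinal.mk_sum, Cardinal.add_eq_self (Cardinal.aleph0_le_mk S.RunId)]
  exact ⟨⟨e ∘ Sum.inl, e ∘ Sum.inr, e.injective.comp Sum.inl_injective,
    e.injective.comp Sum.inr_injective, fun a b h => Sum.inl_ne_inr (e.injective h), C⟩, rfl⟩

namespace RunSplit

variable (w : RunSplit S)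

open Classical in
/-- The constants in `X`, of runs that are split, are constants of the second part. -/
noncomputable def rid (X : Set S.Ident) (x : S.Ident) (rid : S.RunId) : S.RunId :=
  if x ∈ X ∧ rid ∈ w.composed then w.snd rid else w.fst rid

/-- The instantiation of a run that is not split. -/
noncomputable def whole (X : Set S.Ident) (ι : Instantiation S) : Instantiation S where
  rid := w.fst ι.rid
  agents := ι.agents
  values x := (ι.values x).map (Nonce.rename (w.rid X))

/-- The instantiation of the first part of a run that is split. -/
noncomputable def first (X : Set S.Ident) (rs : RoleSpec S) (ι : Instantiation S) :
    Instantiation S where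
  rid := w.fst ι.rid
  agents := ι.agents
  values x := if (rs.type x).isSome then (ι.values x).map (Nonce.rename (w.rid X)) else none

open Classical in
/-- The instantiation of the second part of a run that is split; its parameter `d` has the value
`n`. -/
noncomputable def second (X : Set S.Ident) (d : S.Ident) (n : Nonce S) (rs : RoleSpec S)
    (ι : Instantiation S) : Instantiation S where
  rid := w.snd ι.rid
  agents := ι.agents
  values x := if x = d then some (n.rename (w.rid X)) else
    if (rs.type x).isSome then (ι.values x).map (Nonce.rename (w.rid X)) else none

/-- Constants of the run itself carry an identifier outside `composed`, so they go along `fst` even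
if `Q` uses the same constant. Values may contain constants of split runs and are renamed as such.
-/
theorem whole_translates (X : Set S.Ident) (ty : S.Ident → Option IdentType) :
    Translates (w.rid X) ty ty Set.univ id (fun ι => ι.rid ∉ w.composed) (w.whole X) := by
  have heval : ∀ ι x t, ι.rid ∉ w.composed → Evaluates ty ι x t →
      Evaluates ty (w.whole X ι) x (t.rename (w.rid X)) := by
    intro ι x t hι h
    refine Evaluates.rename (ι := ι) (ι' := w.whole X ι) rfl (fun y _ t h => ?_) h
    obtain ⟨n, rfl, ⟨hy, rfl⟩ | ⟨hy, hn⟩⟩ := evaluates_ident.mp h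
    · refine evaluates_ident.mpr ⟨_, rfl, .inl ⟨hy, ?_⟩⟩
      simp [Nonce.rename, rid, hι, whole]
    · exact evaluates_ident.mpr ⟨_, rfl, .inr ⟨hy, by simp [whole, hn]⟩⟩
  refine ⟨fun _ => rfl, fun ι x t hι _ h => heval ι x t hι h,
    fun ι m t ι' hι _ h => by rwa [h.rid], fun ι m t ι' hι _ h => ?_⟩
  refine ⟨congrArg w.fst h.rid, h.agents, fun x n hn => ?_, ?_,
    heval _ _ _ (by rwa [h.rid]) h.eval⟩
  · obtain ⟨k, hk, rfl⟩ := Option.map_eq_some_iff.mp hn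
    simp [whole, h.extend x k hk]
  · simpa [whole] using h.domain

/-- The typing of a role specification of the chaining composition. -/
noncomputable abbrev _root_.SecProt.chainType (rs₁ rs₂ : RoleSpec S) (c d : S.Ident) :
    S.Ident → Option IdentType :=
  (rs₁.seq (rs₂.subst c d)).type

/-- This covers `c` when the first part types it: its type there takes precedence over the type of
`d` that the substitution assigns to `c`. -/
theorem _root_.SecProt.chainType_of_first {rs₁ rs₂ : RoleSpec S} {c d x : S.Ident}
    (hx : (rs₁.type x).isSome) : chainType rs₁ rs₂ c d x = rs₁.type x := by
  simp [chainType, RoleSpec.seq, Option.or_of_isSome hx]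

theorem _root_.SecProt.chainType_of_second {rs₁ rs₂ : RoleSpec S} {c d x : S.Ident}
    (hx : rs₁.type x = none) (hc : x ≠ c) (hd : x ≠ d) :
    chainType rs₁ rs₂ c d x = rs₂.type x := by
  simp [chainType, RoleSpec.seq, RoleSpec.subst, hx, hc, hd]

/-- The invariant of a run that is split, while it executes its first part: the identifiers of the
second part that have a value are the parameters. -/
structure FirstOk (D : Set S.Role) (rs₂ : RoleSpec S) (c d : S.Ident) (ι : Instantiation S) :
    Prop where
  rid : ι.rid ∈ w.composed
  agents : {r | (ι.agents r).isSome} = D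
  values : ∀ x, (rs₂.type x).isSome → x ≠ c → x ≠ d →
    ((ι.values x).isSome ↔ rs₂.type x = some .param)

/-- Identifiers of the first part lie outside `X`, so its constants go along `fst`. Its reads assign
only identifiers typed by `rs₁`, which `rs₂` does not type; hence they preserve `FirstOk`. -/
theorem first_translates {X : Set S.Ident} {rs₁ rs₂ : RoleSpec S} {c d : S.Ident}
    (h₁ : ∀ x, (rs₁.type x).isSome → x ∉ X) (h₂ : ∀ x, (rs₂.type x).isSome → x ∈ X)
    (D : Set S.Role) :
    Translates (w.rid X) (chainType rs₁ rs₂ c d) rs₁.type {x | (rs₁.type x).isSome} id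
      (w.FirstOk D rs₂ c d) (w.first X rs₁) := by
  have heval : ∀ ι (x : RoleTerm S) t, x.idents ⊆ {x | (rs₁.type x).isSome} →
      Evaluates (chainType rs₁ rs₂ c d) ι x t →
      Evaluates rs₁.type (w.first X rs₁ ι) x (t.rename (w.rid X)) := by
    intro ι x t hx h
    refine Evaluates.rename (ι := ι) (ι' := w.first X rs₁ ι) rfl (fun y hy t h => ?_) h
    have hy : (rs₁.type y).isSome := hx hy
    rw [evaluates_ident, chainType_of_first hy] at h
    obtain ⟨n, rfl, ⟨h, rfl⟩ | ⟨h, hn⟩⟩ := h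
    · refine evaluates_ident.mpr ⟨_, rfl, .inl ⟨h, ?_⟩⟩
      simp [Nonce.rename, rid, h₁ y hy, first]
    · exact evaluates_ident.mpr ⟨_, rfl, .inr ⟨h, by simp [first, hn, hy]⟩⟩
  refine ⟨fun _ => rfl, fun ι x t _ hx h => heval ι x t hx h, fun ι m t ι' hι hm h => ?_,
    fun ι m t ι' hι hm h => ?_⟩
  · refine ⟨by rw [h.rid]; exact hι.rid, by rw [h.agents]; exact hι.agents, fun x hx hc hd => ?_⟩
    rw [← hι.values x hx hc hd]
    have hx' : x ∉ m.idents := fun hxm => h₁ x (hm hxm) (h₂ x hx)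
    have := Set.ext_iff.mp h.domain x
    simpa [hx'] using this
  · refine ⟨congrArg w.fst h.rid, h.agents, fun x n hn => ?_, ?_, heval _ _ _ hm h.eval⟩
    · simp only [first] at hn ⊢
      split_ifs at hn ⊢ with hx
      obtain ⟨k, hk, rfl⟩ := Option.map_eq_some_iff.mp hn
      simp [h.extend x k hk]
    · ext x
      have := Set.ext_iff.mp h.domain x
      by_cases hx : (rs₁.type x).isSome
      · simpa [first, hx, chainType_of_first hx] using this
      · have hxm : x ∉ m.idents := fun h => hx (hm h)
        simp [first, hx, hxm]

/-- The invariant of a run that is split, while it executes its second part. -/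
structure SecondOk (ty : S.Ident → Option IdentType) (c : S.Ident) (n : Nonce S)
    (ι : Instantiation S) : Prop where
  rid : ι.rid ∈ w.composed
  input : Evaluates ty ι (.ident c) (.nonce n)

/-- Where the composed run evaluates `c`, the second part evaluates its parameter `d`; the value `n`
of `c` is already fixed, and later reads only extend the instantiation. All other identifiers of the
second part lie in `X`, so its constants go along `snd`. -/
theorem second_translates {X : Set S.Ident} {rs₁ rs₂ : RoleSpec S} {c d : S.Ident}
    (h₁ : ∀ x, (rs₁.type x).isSome → x ∉ X) (h₂ : ∀ x, (rs₂.type x).isSome → x ∈ X)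
    (hc : (rs₁.type c).isSome) (hd : rs₂.type d = some .param) (n : Nonce S) :
    Translates (w.rid X) (chainType rs₁ rs₂ c d) rs₂.type {x | (rs₂.type x).isSome}
      (RoleTerm.subst c d) (w.SecondOk (chainType rs₁ rs₂ c d) c n) (w.second X d n rs₂) := by
  have hty : ∀ x, (rs₂.type x).isSome → x ≠ d → chainType rs₁ rs₂ c d x = rs₂.type x := by
    intro x hx hxd
    refine chainType_of_second ?_ ?_ hxd
    · rw [← Option.not_isSome_iff_eq_none]
      exact fun h => h₁ x h (h₂ x hx)
    · rintro rfl
      exact h₁ x hc (h₂ x hx)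
  have heval : ∀ ι (x : RoleTerm S) t, w.SecondOk (chainType rs₁ rs₂ c d) c n ι →
      x.idents ⊆ {x | (rs₂.type x).isSome} →
      Evaluates (chainType rs₁ rs₂ c d) ι (x.subst c d) t →
      Evaluates rs₂.type (w.second X d n rs₂ ι) x (t.rename (w.rid X)) := by
    intro ι x t hι hx h
    refine Evaluates.rename_of_subst (ι := ι) (ι' := w.second X d n rs₂ ι) rfl (fun y hy t h => ?_) h
    have hy : (rs₂.type y).isSome := hx hy
    split_ifs at h with hyd
    · subst hyd
      obtain ⟨k, rfl, hk⟩ := evaluates_ident.mp h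
      obtain ⟨n', hn', hk'⟩ := evaluates_ident.mp hι.input
      obtain rfl := RunTerm.nonce.inj hn'
      -- Both are values of `c` in the same context; the mixed cases would make `c` a constant and a
      -- non-constant at once.
      obtain rfl : k = n := by
        obtain ⟨hk₁, rfl⟩ | ⟨hk₁, hk⟩ := hk <;> obtain ⟨hk₂, rfl⟩ | ⟨hk₂, hk'⟩ := hk'
        · rfl
        · simp [hk₁] at hk₂
        · simp [hk₂] at hk₁
        · exact Option.some.inj (hk.symm.trans hk')
      exact evaluates_ident.mpr ⟨_, rfl, .inr ⟨.inl hd, by simp [second]⟩⟩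
    · rw [evaluates_ident, hty y hy hyd] at h
      obtain ⟨k, rfl, ⟨h, rfl⟩ | ⟨h, hn⟩⟩ := h
      · refine evaluates_ident.mpr ⟨_, rfl, .inl ⟨h, ?_⟩⟩
        simp [Nonce.rename, RunSplit.rid, h₂ y hy, second, hι.rid]
      · exact evaluates_ident.mpr ⟨_, rfl, .inr ⟨h, by simp [second, hn, hy, hyd]⟩⟩
  have hok : ∀ ι m t ι', w.SecondOk (chainType rs₁ rs₂ c d) c n ι →
      Matches (chainType rs₁ rs₂ c d) ι m t ι' →
      w.SecondOk (chainType rs₁ rs₂ c d) c n ι' := by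
    intro ι m t ι' hι h
    refine ⟨by rw [h.rid]; exact hι.rid, ?_⟩
    obtain ⟨k, hk, ⟨h', rfl⟩ | ⟨h', hv⟩⟩ := evaluates_ident.mp hι.input
    · exact evaluates_ident.mpr ⟨_, hk, .inl ⟨h', by rw [h.rid]⟩⟩
    · exact evaluates_ident.mpr ⟨_, hk, .inr ⟨h', h.extend _ _ hv⟩⟩
  refine ⟨fun _ => rfl, fun ι x t hι hx h => heval ι x t hι hx h,
    fun ι m t ι' hι _ h => hok _ _ _ _ hι h, fun ι m t ι' hι hm h => ?_⟩
  refine ⟨congrArg w.snd h.rid, h.agents, fun x k hk => ?_, ?_,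
    heval _ _ _ (hok _ _ _ _ hι h) hm h.eval⟩
  · simp only [second] at hk ⊢
    split_ifs at hk ⊢ with hxd hx
    · exact hk
    · obtain ⟨j, hj, rfl⟩ := Option.map_eq_some_iff.mp hk
      simp [h.extend x j hj]
  · ext x
    have hx := Set.ext_iff.mp h.domain x
    -- The parameter `d` has a value before and after the read, so it never counts as newly
    -- assigned.
    by_cases hxd : x = d
    · simp [second, hxd]
    · by_cases hx₂ : (rs₂.type x).isSome
      · have hxc : x ≠ c := by
          rintro rfl
          exact h₁ x hc (h₂ x hx₂)
        simpa [second, hxd, hx₂, hty x hx₂ hxd, RoleTerm.mem_idents_subst hxc hxd] using hx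
      · have hxm : x ∉ m.idents := fun h => hx₂ (hm h)
        simp [second, hxd, hx₂, hxm]

end RunSplit

end SecProt

namespace SecProt

variable {S : Signature}

/-! ### The simulation relation -/

/-- The chaining composition is defined, and both protocol sets are well-formed. -/
structure ChainSetting (K : InitialKnowledge S) (P Q : Protocol S) (c d : S.Ident)
    (Prots : Set (Protocol S)) (lam : S.Label → S.Label) : Prop where
  chainDefined : ChainDefined K P Q c d
  split : IsProtocolSet ({P, Q} ∪ Prots)
  comp : IsProtocolSet ({chain lam P Q c d} ∪ Prots)

section Sim

variable (w : RunSplit S) (P Q : Protocol S) (c d : S.Ident) (Prots : Set (Protocol S))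
  (lam : S.Label → S.Label)

/-- A run of a protocol other than the chaining composition. -/
inductive WholeSim (F : Set (Run S)) : Run S → Prop
  | intro {ι : Instantiation S} {el : List (Event S)} {R : Protocol S} {r : S.Role}
      {rs : RoleSpec S} (hR : R ∈ Prots) (hne : R ≠ chain lam P Q c d) (hr : R r = some rs)
      (hel : ∀ e ∈ el, e ∈ rs.events) (hι : ι.rid ∉ w.composed)
      (h : (w.whole Q.idents ι, el) ∈ F) : WholeSim F (ι, el)

/-- A run of the chaining composition that is simulated by a run of the first protocol. -/
inductive FirstSim (F : Set (Run S)) : Run S → Prop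
  | intro {ι : Instantiation S} {rest : List (Event S)} {ℓ : S.Label} {r : S.Role}
      {rs₁ rs₂ : RoleSpec S} (h₁ : P r = some rs₁) (h₂ : Q r = some rs₂)
      (hrest : ∀ e ∈ rest, e ∈ rs₁.events.dropLast) (hfin : Event.finish ℓ r ∈ rs₁.events)
      (hι : w.FirstOk P.dom rs₂ c d ι)
      (h : (w.first Q.idents rs₁ ι, rest ++ [.finish ℓ r]) ∈ F)
      (hnew : ∀ run ∈ F, run.1.rid ≠ w.snd ι.rid) :
      FirstSim F (ι, rest.map (Event.mapTerm lam id) ++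
        rs₂.events.tail.map (Event.mapTerm lam (RoleTerm.subst c d)))

/-- A run of the chaining composition that is simulated by a run of the second protocol. -/
inductive SecondSim (F : Set (Run S)) : Run S → Prop
  | intro {ι : Instantiation S} {rest : List (Event S)} {r : S.Role} {rs₁ rs₂ : RoleSpec S}
      {n : Nonce S} (h₁ : P r = some rs₁) (h₂ : Q r = some rs₂) (hc : (rs₁.type c).isSome)
      (hrest : ∀ e ∈ rest, e ∈ rs₂.events.tail) (hι : w.SecondOk (chainType rs₁ rs₂ c d) c n ι)
      (h : (w.second Q.idents d n rs₂ ι, rest) ∈ F) :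
      SecondSim F (ι, rest.map (Event.mapTerm lam (RoleTerm.subst c d)))

def RunSim (F : Set (Run S)) (run : Run S) : Prop :=
  WholeSim w P Q c d Prots lam F run ∨ FirstSim w P Q c d lam F run ∨
    SecondSim w P Q c d lam F run

/-- `origin` guarantees that both identifiers reserved for a new run are still unused in the
simulating state. -/
structure StateSim (F F' : Set (Run S)) : Prop where
  sim : ∀ run ∈ F, RunSim w P Q c d Prots lam F' run
  origin : ∀ run' ∈ F', ∃ run ∈ F, run'.1.rid = w.fst run.1.rid ∨ run'.1.rid = w.snd run.1.rid

/-- Every create event of the second protocol comes right after a finish event of the first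
protocol that provides its input. -/
def InputChained (α : Trace S) : Prop :=
  ∀ j ι ℓ r, α[j]? = some (ι, Event.create ℓ r) → ℓ ∈ Q.labels →
    ∃ i ι' ℓ' n, j = i + 1 ∧ α[i]? = some (ι', Event.finish ℓ' r) ∧ ℓ' ∈ P.labels ∧
      ι'.agents = ι.agents ∧ ι.values d = some n ∧
      Denotes ({P, Q} ∪ Prots) (ι', .finish ℓ' r) (.ident c) (.nonce n)

/-- Equality of the agents transfers the exemption for untrusted agents; the link through `lam`
later identifies the original label. -/
def ClaimsMatch (α α' : Trace S) : Prop :=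
  ∀ ι ℓ' r m', (ι, Event.claim ℓ' r .secret (some m')) ∈ α → ℓ' ∈ (chain lam P Q c d).labels →
    ∃ ι' ℓ m, (ι', Event.claim ℓ r .secret (some m)) ∈ α' ∧ ι'.agents = ι.agents ∧ lam ℓ = ℓ' ∧
      ℓ ∈ P.labels ∪ Q.labels ∧
      ∀ t, Denotes ({chain lam P Q c d} ∪ Prots) (ι, .claim ℓ' r .secret (some m')) m' t →
        Denotes ({P, Q} ∪ Prots) (ι', .claim ℓ r .secret (some m)) m (t.rename (w.rid Q.idents))

/-- `α'` may be longer than `α`, since the end of a `P`-run and the creation of a `Q`-run have no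
counterpart in `α`. -/
structure Simulates (K : InitialKnowledge S) (α : Trace S) (s : State S) (α' : Trace S)
    (s' : State S) : Prop where
  derives : Derives K ({P, Q} ∪ Prots) α' s'
  knowledge : ∀ t ∈ s.knowledge, t.rename (w.rid Q.idents) ∈ s'.knowledge
  runs : StateSim w P Q c d Prots lam s.runs s'.runs
  input : InputChained P Q c d Prots α'
  claims : ClaimsMatch w P Q c d Prots lam α α'

/-- The next event `e` of a run can be simulated by the execution of `e'`. -/
structure Active (F' : Set (Run S)) (ι : Instantiation S) (e : Event S) (el : List (Event S))
    (ty : S.Ident → Option IdentType) (rs : RoleSpec S) (X : Set S.Ident)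
    (f : RoleTerm S → RoleTerm S) (Ok : Instantiation S → Prop)
    (T : Instantiation S → Instantiation S) (lam' : S.Label → S.Label) (e' : Event S)
    (el' : List (Event S)) : Prop where
  translates : Translates (w.rid Q.idents) ty rs.type X f Ok T
  event : e = e'.mapTerm lam' f
  idents : e'.idents ⊆ X
  context : ∀ rs₀, IsContext ({chain lam P Q c d} ∪ Prots) e rs₀ → rs₀.type = ty
  context' : IsContext ({P, Q} ∪ Prots) e' rs
  ok : Ok ι
  mem : (T ι, e' :: el') ∈ F'
  rid : (T ι).rid = w.fst ι.rid ∨ (T ι).rid = w.snd ι.rid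
  finish : ∀ ℓ r, e' = .finish ℓ r → el = [] → el' = []
  label : e.label ∈ (chain lam P Q c d).labels →
    lam e'.label = e.label ∧ e'.label ∈ P.labels ∪ Q.labels
  next : ∀ ι₁ F'', Ok ι₁ → ι₁.rid = ι.rid → (T ι₁, el') ∈ F'' →
    (∀ run ∈ F'', run ∈ F' ∨ run = (T ι₁, el')) → RunSim w P Q c d Prots lam F'' (ι₁, el)

end Sim

/-! ### Stability of the simulation relation -/

variable {w : RunSplit S} {P Q : Protocol S} {c d : S.Ident} {Prots : Set (Protocol S)}
  {lam : S.Label → S.Label} {K : InitialKnowledge S}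

/-- Locality: the simulation of a run looks only at the two identifiers derived from its own. -/
theorem RunSim.congr {F F' : Set (Run S)} {run : Run S} (h : RunSim w P Q c d Prots lam F run)
    (hF : ∀ run', run'.1.rid = w.fst run.1.rid ∨ run'.1.rid = w.snd run.1.rid →
      (run' ∈ F' ↔ run' ∈ F)) : RunSim w P Q c d Prots lam F' run := by
  obtain ⟨hR, hne, hr, hel, hι, h⟩ | ⟨h₁, h₂, hrest, hfin, hι, h, hnew⟩ |
    ⟨h₁, h₂, hc, hrest, hι, h⟩ := h
  · exact .inl ⟨hR, hne, hr, hel, hι, (hF _ (.inl rfl)).mpr h⟩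
  · exact .inr (.inl ⟨h₁, h₂, hrest, hfin, hι, (hF _ (.inl rfl)).mpr h,
      fun run hrun heq => hnew run ((hF _ (.inr heq)).mp hrun) heq⟩)
  · exact .inr (.inr ⟨h₁, h₂, hc, hrest, hι, (hF _ (.inr rfl)).mpr h⟩)

theorem RunSplit.ne_of_rid_ne (w : RunSplit S) {a b x : S.RunId} (hab : a ≠ b)
    (hx : x = w.fst a ∨ x = w.snd a) : x ≠ w.fst b ∧ x ≠ w.snd b := by
  obtain rfl | rfl := hx
  · exact ⟨fun h => hab (w.fst_injective h), w.fst_ne_snd _ _⟩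
  · exact ⟨fun h => w.fst_ne_snd _ _ h.symm, fun h => hab (w.snd_injective h)⟩

/-- By locality, only the run that moved has to be checked again. The case `F₁ = F` is allowed, for
moves of the simulating system alone. -/
theorem StateSim.update {F F₁ F' F'' : Set (Run S)} (h : StateSim w P Q c d Prots lam F F')
    {new : Run S} (hnew : new ∈ F₁) (hF₁ : ∀ run ∈ F₁, run = new ∨ run ∈ F ∧ run.1.rid ≠ new.1.rid)
    (hF : ∀ run ∈ F, run ∈ F₁ ∨ run.1.rid = new.1.rid)
    (hF' : ∀ run' : Run S, run'.1.rid ≠ w.fst new.1.rid → run'.1.rid ≠ w.snd new.1.rid →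
      (run' ∈ F'' ↔ run' ∈ F')) (hsim : RunSim w P Q c d Prots lam F'' new) :
    StateSim w P Q c d Prots lam F₁ F'' := by
  constructor
  · intro run hrun
    obtain rfl | ⟨hrun, hne⟩ := hF₁ run hrun
    · exact hsim
    · refine (h.sim run hrun).congr fun run' hrun' => ?_
      obtain ⟨h₁, h₂⟩ := w.ne_of_rid_ne hne hrun'
      exact hF' run' h₁ h₂
  · intro run' hrun'
    by_cases h₁ : run'.1.rid = w.fst new.1.rid
    · exact ⟨new, hnew, .inl h₁⟩
    by_cases h₂ : run'.1.rid = w.snd new.1.rid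
    · exact ⟨new, hnew, .inr h₂⟩
    obtain ⟨run, hrun, hr⟩ := h.origin run' ((hF' run' h₁ h₂).mp hrun')
    obtain hrun | heq := hF run hrun
    · exact ⟨run, hrun, hr⟩
    · rw [heq] at hr
      exact ⟨new, hnew, hr⟩

theorem eq_of_getElem?_singleton {β : Type*} {a b : β} {i : ℕ} (h : [a][i]? = some b) :
    i = 0 ∧ a = b := by
  rw [List.getElem?_singleton] at h
  split_ifs at h with hi
  exact ⟨hi, Option.some.inj h⟩

theorem InputChained.append {α : Trace S} (h : InputChained P Q c d Prots α) {e : RunEvent S}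
    (he : ∀ ℓ r, e.2 = .create ℓ r → ℓ ∉ Q.labels) : InputChained P Q c d Prots (α ++ [e]) := by
  intro j ι ℓ r hj hℓ
  obtain hlt | hge := lt_or_ge j α.length
  · rw [List.getElem?_append_left hlt] at hj
    obtain ⟨i, ι', ℓ', n, rfl, hi, h⟩ := h j ι ℓ r hj hℓ
    exact ⟨i, ι', ℓ', n, rfl, by rw [List.getElem?_append_left (by omega), hi], h⟩
  · rw [List.getElem?_append_right hge] at hj
    obtain ⟨-, rfl⟩ := eq_of_getElem?_singleton hj
    exact (he ℓ r rfl hℓ).elim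

theorem InputChained.append_pair {α : Trace S} (h : InputChained P Q c d Prots α)
    {ι ι' : Instantiation S} {ℓ ℓ' : S.Label} {r : S.Role} {n : Nonce S} (hℓ' : ℓ' ∈ P.labels)
    (hag : ι'.agents = ι.agents) (hn : ι.values d = some n)
    (hden : Denotes ({P, Q} ∪ Prots) (ι', .finish ℓ' r) (.ident c) (.nonce n)) :
    InputChained P Q c d Prots (α ++ [(ι', .finish ℓ' r)] ++ [(ι, .create ℓ r)]) := by
  have h' : InputChained P Q c d Prots (α ++ [(ι', .finish ℓ' r)]) := h.append (by simp)
  intro j ι₀ ℓ₀ r₀ hj hℓ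
  obtain hlt | hge := lt_or_ge j (α ++ [(ι', Event.finish ℓ' r)]).length
  · rw [List.getElem?_append_left hlt] at hj
    obtain ⟨i, ι', ℓ', n, rfl, hi, h⟩ := h' j ι₀ ℓ₀ r₀ hj hℓ
    exact ⟨i, ι', ℓ', n, rfl, by rw [List.getElem?_append_left (by omega), hi], h⟩
  · rw [List.getElem?_append_right hge] at hj
    obtain ⟨hj', heq⟩ := eq_of_getElem?_singleton hj
    cases heq
    rw [List.length_append, List.length_singleton] at hj' hge
    exact ⟨α.length, ι', ℓ', n, by omega, by simp, hℓ', hag, hn, hden⟩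

/-- The source of a create event at `j` is the finish event at `j - 1`; this choice is injective and
strictly earlier. -/
theorem InputChained.uniqueInput {α : Trace S} (h : InputChained P Q c d Prots α)
    (hset : IsProtocolSet ({P, Q} ∪ Prots))
    (hd : ∀ r rs, Q r = some rs → rs.type d = some .param) :
    UniqueInput ({P, Q} ∪ Prots) {P} {Q} c d α := by
  intro i ι ℓ r hi _
  have key : ∀ j ∈ sameInput ({P, Q} ∪ Prots) {Q} d α i,
      ∃ k ∈ sources ({P, Q} ∪ Prots) {P} c d α i, j = k + 1 := by
    rintro j ⟨ι, ℓ, r, ι', ℓ', t, hi, hj, ⟨_, rfl, hℓ'⟩, hag, hit, hjt⟩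
    obtain ⟨k, ι'', ℓ'', n, rfl, hk, hℓ'', hag', hn, hden⟩ := h j ι' ℓ' r hj hℓ'
    refine ⟨k, ⟨ι, ℓ, r, ι'', ℓ'', t, hi, hk, ⟨P, rfl, hℓ''⟩, hag'.trans hag, hit, ?_⟩, rfl⟩
    -- The value `t` of `d` at the create event is the `n` supplied by the chained finish event,
    -- because `d` is a parameter of `Q`.
    obtain ⟨rs, ⟨R, hR, r', hr', he⟩, hev⟩ := hjt
    obtain rfl := hset.eq_of_label hR (.inl (.inr rfl)) (Protocol.mem_labels hr' he) hℓ'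
    obtain ⟨n', rfl, ⟨hc, -⟩ | ⟨-, hn'⟩⟩ := evaluates_ident.mp hev
    · simp [hd r' rs hr'] at hc
    · obtain rfl := Option.some.inj (hn.symm.trans hn')
      exact hden
  choose! f hf hf' using key
  refine ⟨fun j => ⟨f j, hf j j.2⟩, ?_, fun j => ?_⟩
  · rintro ⟨j, hj⟩ ⟨k, hk⟩ heq
    rw [Subtype.mk.injEq] at heq
    rw [Subtype.mk.injEq, hf' j hj, hf' k hk, heq]
  · have := hf' j j.2
    change f j < j
    omega

theorem ClaimsMatch.mono {α α' α'' : Trace S} (h : ClaimsMatch w P Q c d Prots lam α α')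
    (hα : ∀ e ∈ α', e ∈ α'') : ClaimsMatch w P Q c d Prots lam α α'' := by
  intro ι ℓ' r m' hm hℓ'
  obtain ⟨ι', ℓ, m, hmem, h⟩ := h ι ℓ' r m' hm hℓ'
  exact ⟨ι', ℓ, m, hα _ hmem, h⟩

theorem ClaimsMatch.append {α α' α'' : Trace S} (h : ClaimsMatch w P Q c d Prots lam α α')
    (hα : ∀ e ∈ α', e ∈ α'') {e : RunEvent S}
    (he : ClaimsMatch w P Q c d Prots lam [e] α'') :
    ClaimsMatch w P Q c d Prots lam (α ++ [e]) α'' := by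
  intro ι ℓ' r m' hm hℓ'
  obtain hm | hm := List.mem_append.mp hm
  · exact h.mono hα ι ℓ' r m' hm hℓ'
  · exact he ι ℓ' r m' hm hℓ'

/-! ### Simulation of the steps -/

theorem chain_eq_some {r : S.Role} {rs₁ rs₂ : RoleSpec S} (h₁ : P r = some rs₁)
    (h₂ : Q r = some rs₂) :
    chain lam P Q c d r = some ((rs₁.seq (rs₂.subst c d)).relabel lam) := by
  simp [chain, h₁, h₂]

theorem exists_of_chain_eq_some {r : S.Role} {rs : RoleSpec S}
    (h : chain lam P Q c d r = some rs) : ∃ rs₁ rs₂, P r = some rs₁ ∧ Q r = some rs₂ ∧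
      rs = (rs₁.seq (rs₂.subst c d)).relabel lam := by
  unfold chain at h
  split at h
  · exact ⟨_, _, ‹_›, ‹_›, (Option.some.inj h).symm⟩
  · simp at h

theorem chain_events (rs₁ rs₂ : RoleSpec S) :
    ((rs₁.seq (rs₂.subst c d)).relabel lam).events =
      rs₁.events.dropLast.map (Event.mapTerm lam id) ++
        rs₂.events.tail.map (Event.mapTerm lam (RoleTerm.subst c d)) := by
  simp only [RoleSpec.relabel, RoleSpec.seq, RoleSpec.subst, List.map_append, List.map_tail,
    List.map_map]
  congr 2
  · funext e
    exact (e.mapTerm_relabel lam).symm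
  · congr 1
    funext e
    exact (e.mapTerm_subst lam c d).symm

namespace ChainSetting

theorem not_mem_idents (h : ChainSetting K P Q c d Prots lam) {r : S.Role} {rs : RoleSpec S}
    (hr : P r = some rs) : ∀ x, (rs.type x).isSome → x ∉ Q.idents := fun _ hx =>
  Set.disjoint_left.mp h.chainDefined.idents_disjoint (Protocol.mem_idents hr hx)

theorem first_wellFormed (h : ChainSetting K P Q c d Prots lam) {r : S.Role} {rs : RoleSpec S}
    (hr : P r = some rs) : rs.WellFormed r :=
  (h.split.wellFormed P (.inl (.inl rfl))).roles r rs hr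

theorem second_wellFormed (h : ChainSetting K P Q c d Prots lam) {r : S.Role} {rs : RoleSpec S}
    (hr : Q r = some rs) : rs.WellFormed r :=
  (h.split.wellFormed Q (.inl (.inr rfl))).roles r rs hr

theorem type_eq_chainType (h : ChainSetting K P Q c d Prots lam) {r : S.Role}
    {rs₁ rs₂ : RoleSpec S} (h₁ : P r = some rs₁) (h₂ : Q r = some rs₂) {e : Event S}
    (he : e ∈ ((rs₁.seq (rs₂.subst c d)).relabel lam).events) :
    ∀ rs₀, IsContext ({chain lam P Q c d} ∪ Prots) e rs₀ → rs₀.type = chainType rs₁ rs₂ c d := by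
  intro rs₀ hrs₀
  rw [h.comp.context_unique hrs₀ ⟨_, .inl rfl, r, chain_eq_some h₁ h₂, he⟩]
  rfl

theorem active_of_wholeSim (h : ChainSetting K P Q c d Prots lam) {F' : Set (Run S)}
    {ι : Instantiation S} {e : Event S} {el : List (Event S)}
    (hs : WholeSim w P Q c d Prots lam F' (ι, e :: el)) :
    ∃ ty rs X f Ok T lam' e' el', Active w P Q c d Prots lam F' ι e el ty rs X f Ok T lam' e' el' := by
  obtain ⟨hR, hne, hr, hel, hι, hmem⟩ := hs
  rename_i R r rs
  have he : e ∈ rs.events := hel e (by simp)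
  refine ⟨rs.type, rs, Set.univ, id, _, _, id, e, el, w.whole_translates Q.idents rs.type,
    e.mapTerm_id.symm, Set.subset_univ _, ?_, ⟨R, .inr hR, r, hr, he⟩, hι, hmem, .inl rfl,
    fun _ _ _ h => h, ?_, ?_⟩
  · intro rs₀ hrs₀
    rw [h.comp.context_unique hrs₀ ⟨R, .inr hR, r, hr, he⟩]
  · intro hℓ
    exact (hne (h.comp.eq_of_label (.inr hR) (.inl rfl) (Protocol.mem_labels hr he) hℓ)).elim
  · intro ι₁ F'' hok _ hm _
    exact .inl ⟨hR, hne, hr, fun e he => hel e (by simp [he]), hok, hm⟩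

theorem active_of_secondSim (h : ChainSetting K P Q c d Prots lam) {F' : Set (Run S)}
    {ι : Instantiation S} {e : Event S} {el : List (Event S)}
    (hs : SecondSim w P Q c d lam F' (ι, e :: el)) :
    ∃ ty rs X f Ok T lam' e' el', Active w P Q c d Prots lam F' ι e el ty rs X f Ok T lam' e' el' := by
  generalize hrun : (ι, e :: el) = run at hs
  obtain ⟨h₁, h₂, hc, hrest, hι, hmem⟩ := hs
  rename_i ι' rest r rs₁ rs₂ n
  obtain ⟨rfl, hel⟩ := Prod.mk.inj hrun
  obtain _ | ⟨e', el'⟩ := rest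
  · simp at hel
  obtain ⟨rfl, rfl⟩ := List.cons.inj hel
  have he : e' ∈ rs₂.events := List.mem_of_mem_tail (hrest e' (by simp))
  have hmem' : Event.mapTerm lam (RoleTerm.subst c d) e' ∈
      ((rs₁.seq (rs₂.subst c d)).relabel lam).events := by
    rw [chain_events]
    exact List.mem_append_right _ (List.mem_map_of_mem (hrest e' (by simp)))
  refine ⟨_, rs₂, _, _, _, _, lam, e', el',
    w.second_translates (h.not_mem_idents h₁) (fun x => Protocol.mem_idents h₂) hc
      (h.chainDefined.param r rs₂ h₂) n, rfl, (h.second_wellFormed h₂).typed e' he,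
    h.type_eq_chainType h₁ h₂ hmem', ⟨Q, .inl (.inr rfl), r, h₂, he⟩, hι, hmem, .inr rfl,
    fun _ _ _ h => by simpa using h,
    fun _ => ⟨(Event.label_mapTerm _ _ _).symm, .inr (Protocol.mem_labels h₂ he)⟩, ?_⟩
  intro ι₁ F'' hok _ hm _
  exact .inr (.inr ⟨h₁, h₂, hc, fun e he => hrest e (by simp [he]), hok, hm⟩)

/-- A run of the chaining composition that has reached the end of its first part. -/
def _root_.SecProt.Pending (w : RunSplit S) (P Q : Protocol S) (c d : S.Ident)
    (lam : S.Label → S.Label) (F' : Set (Run S)) (ι : Instantiation S) (el : List (Event S)) :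
    Prop :=
  ∃ ℓ r rs₁ rs₂, P r = some rs₁ ∧ Q r = some rs₂ ∧ Event.finish ℓ r ∈ rs₁.events ∧
    w.FirstOk P.dom rs₂ c d ι ∧ (w.first Q.idents rs₁ ι, [.finish ℓ r]) ∈ F' ∧
    (∀ run ∈ F', run.1.rid ≠ w.snd ι.rid) ∧
    el = rs₂.events.tail.map (Event.mapTerm lam (RoleTerm.subst c d))

/-- The alternative is whether an event of `P` other than the end event remains. If none does, the
next event belongs to `Q` while the `P`-run still has to end. -/
theorem active_or_pending_of_firstSim (h : ChainSetting K P Q c d Prots lam) {F' : Set (Run S)}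
    {ι : Instantiation S} {e : Event S} {el : List (Event S)}
    (hs : FirstSim w P Q c d lam F' (ι, e :: el)) :
    (∃ ty rs X f Ok T lam' e' el',
      Active w P Q c d Prots lam F' ι e el ty rs X f Ok T lam' e' el') ∨
    Pending w P Q c d lam F' ι (e :: el) := by
  generalize hrun : (ι, e :: el) = run at hs
  obtain ⟨h₁, h₂, hrest, hfin, hι, hmem, hnew⟩ := hs
  rename_i ι' rest ℓ r rs₁ rs₂
  obtain ⟨rfl, hel⟩ := Prod.mk.inj hrun
  obtain _ | ⟨e', el'⟩ := rest
  · exact .inr ⟨ℓ, r, rs₁, rs₂, h₁, h₂, hfin, hι, hmem, hnew, by simpa using hel⟩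
  left
  obtain ⟨rfl, rfl⟩ := List.cons.inj hel
  have he' : e' ∈ rs₁.events.dropLast := hrest e' (by simp)
  have he : e' ∈ rs₁.events := List.mem_of_mem_dropLast he'
  have hmem' : Event.mapTerm lam id e' ∈ ((rs₁.seq (rs₂.subst c d)).relabel lam).events := by
    rw [chain_events]
    exact List.mem_append_left _ (List.mem_map_of_mem he')
  refine ⟨_, rs₁, _, _, _, _, lam, e', el' ++ [Event.finish ℓ r],
    w.first_translates (h.not_mem_idents h₁) (fun x => Protocol.mem_idents h₂) P.dom, rfl,
    (h.first_wellFormed h₁).typed e' he,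
    h.type_eq_chainType h₁ h₂ hmem', ⟨P, .inl (.inl rfl), r, h₁, he⟩, hι, hmem, .inl rfl,
    fun ℓ' r' hf => ((h.first_wellFormed h₁).ne_finish he' ℓ' r' hf).elim,
    fun _ => ⟨(Event.label_mapTerm _ _ _).symm, .inl (Protocol.mem_labels h₁ he)⟩, ?_⟩
  intro ι₁ F'' hok hrid hm hF''
  refine .inr (.inl ⟨h₁, h₂, fun e he => hrest e (by simp [he]), hfin, hok, hm, ?_⟩)
  intro run hrun
  rw [hrid]
  obtain hrun | rfl := hF'' run hrun
  · exact hnew run hrun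
  · exact w.fst_ne_snd _ _

/-- At the end of the first part, the run of the first protocol is finished and the one of the
second protocol is created. -/
theorem exists_simulates_secondSim (h : ChainSetting K P Q c d Prots lam) {α α' : Trace S}
    {s s' : State S} (hs : Simulates w P Q c d Prots lam K α s α' s')
    (hd : Derives K ({chain lam P Q c d} ∪ Prots) α s) {ι : Instantiation S}
    {el : List (Event S)} (hmem : (ι, el) ∈ s.runs) (hp : Pending w P Q c d lam s'.runs ι el) :
    ∃ α'' s'', Simulates w P Q c d Prots lam K α s α'' s'' ∧
      SecondSim w P Q c d lam s''.runs (ι, el) := by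
  obtain ⟨ℓ, r, rs₁, rs₂, h₁, h₂, hfin, hι, hrun, hnew, rfl⟩ := hp
  have hd₁ := hs.derives.snoc (Step.finish (K := s'.knowledge) hrun)
  have hPlabel : ℓ ∈ P.labels := Protocol.mem_labels h₁ hfin
  -- Establishment speaks of finish events that occur in a trace, so it is applied to the simulating
  -- trace already extended by this one.
  obtain ⟨t, hden⟩ := h.chainDefined.establishes _ h.split (.inl (.inl rfl)) _ ⟨_, hd₁⟩
    (w.first Q.idents rs₁ ι) ℓ r (by simp) hPlabel
  have hev : Evaluates rs₁.type (w.first Q.idents rs₁ ι) (.ident c) t := by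
    obtain ⟨rs, hctx, hev⟩ := hden
    rwa [h.split.context_unique hctx ⟨P, .inl (.inl rfl), r, h₁, hfin⟩] at hev
  have hc : (rs₁.type c).isSome := by
    obtain ⟨-, -, ⟨h, -⟩ | ⟨h | h, -⟩⟩ := evaluates_ident.mp hev <;> simp [h]
  -- The value of `c` in the `P`-run is pulled back along the renaming to its value in the composed
  -- run. If `c` is a constant, this works because it is not an identifier of `Q` and is thus
  -- renamed along `fst`.
  obtain ⟨n, rfl, hn⟩ : ∃ n : Nonce S, t = .nonce (n.rename (w.rid Q.idents)) ∧
      Evaluates (chainType rs₁ rs₂ c d) ι (.ident c) (.nonce n) := by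
    obtain ⟨k, rfl, ⟨hty, rfl⟩ | ⟨hty, hk⟩⟩ := evaluates_ident.mp hev
    · refine ⟨.fresh c ι.rid, ?_, .const (by rwa [chainType_of_first hc])⟩
      simp [Nonce.rename, RunSplit.rid, h.not_mem_idents h₁ c hc, RunSplit.first]
    · simp only [RunSplit.first, hc, if_true] at hk
      obtain ⟨n, hn, rfl⟩ := Option.map_eq_some_iff.mp hk
      exact ⟨n, rfl, .value (by rwa [chainType_of_first hc]) hn⟩
  have hparam := h.chainDefined.param r rs₂ h₂
  obtain ⟨ℓ₂, ℓ₃, inner, hshape, -⟩ := (h.second_wellFormed h₂).shape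
  -- A created run must have values at exactly its parameters: `d` receives `n`, and `FirstOk`
  -- settles the remaining identifiers of `Q`.
  have hinit : IsInitialRun ({P, Q} ∪ Prots)
      (w.second Q.idents d n rs₂ ι, .create ℓ₂ r :: rs₂.events.tail) := by
    refine ⟨Q, .inl (.inr rfl), r, rs₂, h₂, by simp [hshape], ?_, ?_⟩
    · rw [← h.chainDefined.dom_eq]
      exact hι.agents
    · ext x
      by_cases hxd : x = d
      · simp [RunSplit.second, hxd, hparam]
      · by_cases hx : (rs₂.type x).isSome
        · have hxc : x ≠ c := by
            rintro rfl
            exact h.not_mem_idents h₁ x hc (Protocol.mem_idents h₂ hx)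
          simpa [RunSplit.second, hxd, hx] using hι.values x hx hxc hxd
        · have : rs₂.type x ≠ some .param := by
            rintro h
            simp [h] at hx
          simp [RunSplit.second, hxd, hx, this]
  have hd₂ := hd₁.snoc (Step.create hinit (by
    intro run hrun'
    obtain ⟨hrun', -⟩ | rfl := mem_replaceRun.mp hrun'
    · exact hnew run hrun'
    · exact w.fst_ne_snd _ _))
  have hsim : SecondSim w P Q c d lam
      (replaceRun s'.runs (w.first Q.idents rs₁ ι, []) (w.first Q.idents rs₁ ι, [.finish ℓ r]) ∪
        {(w.second Q.idents d n rs₂ ι, rs₂.events.tail)})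
      (ι, rs₂.events.tail.map (Event.mapTerm lam (RoleTerm.subst c d))) :=
    ⟨h₁, h₂, hc, fun _ he => he, ⟨hι.rid, hn⟩, .inr rfl⟩
  refine ⟨_, _, ⟨hd₂, hs.knowledge, ?_, ?_, ?_⟩, hsim⟩
  -- The composed system stands still here; only the image of this run changes.
  · refine hs.runs.update hmem (fun run hrun => ?_) (fun run hrun => .inl hrun) ?_ (.inr (.inr hsim))
    · by_cases hr : run.1.rid = ι.rid
      · exact .inl (hd.runs_injOn hrun hmem hr)
      · exact .inr ⟨hrun, hr⟩
    · intro run' hr₁ hr₂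
      constructor
      · rintro (h | rfl)
        · rwa [mem_replaceRun_of_rid_ne hr₁ hr₁] at h
        · exact (hr₂ rfl).elim
      · exact fun h => .inl ((mem_replaceRun_of_rid_ne hr₁ hr₁).mpr h)
  · exact hs.input.append_pair hPlabel rfl (by simp [RunSplit.second]) hden
  · exact hs.claims.mono fun e he => by simp [he]

/-- `Active` makes the three kinds of simulated runs uniform, so that a single argument handles
every event other than a creation. -/
theorem _root_.SecProt.exists_simulates_of_active {α α' : Trace S}
    {s s₁ s' : State S} {e : RunEvent S} (hs : Simulates w P Q c d Prots lam K α s α' s')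
    (hd : Derives K ({chain lam P Q c d} ∪ Prots) α s) {ι : Instantiation S}
    {el : List (Event S)} (hmem : (ι, e.2 :: el) ∈ s.runs)
    (hfin : ∀ ℓ r, e.2 = .finish ℓ r → el = [])
    (hex : Executes ({chain lam P Q c d} ∪ Prots) s.knowledge ι e.2 s₁.knowledge e.1)
    (hs₁ : s₁.runs = replaceRun s.runs (e.1, el) (ι, e.2 :: el))
    (hact : ∃ ty rs X f Ok T lam' e' el',
      Active w P Q c d Prots lam s'.runs ι e.2 el ty rs X f Ok T lam' e' el') :
    ∃ α'' s'', Simulates w P Q c d Prots lam K (α ++ [e]) s₁ α'' s'' := by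
  obtain ⟨ι₁, e⟩ := e
  obtain ⟨ty, rs, X, f, Ok, T, lam', e', el', hact⟩ := hact
  obtain rfl : e = e'.mapTerm lam' f := hact.event
  dsimp only at *
  obtain ⟨K₁', hex', hK₁', hok⟩ := hact.translates.executes hact.idents hact.context hact.context'
    hact.ok hs.knowledge hex
  have hstep := hex'.step hact.mem fun ℓ r he' =>
    hact.finish ℓ r he' (hfin (lam' ℓ) r (by rw [he']; rfl))
  have hrid : ι₁.rid = ι.rid := hex.rid
  have hrid' : (T ι₁).rid = (T ι).rid := hex'.rid
  refine ⟨_, _, hs.derives.snoc hstep, hK₁', ?_, ?_, ?_⟩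
  · rw [hs₁]
    refine hs.runs.update (new := (ι₁, el)) (mem_replaceRun.mpr (.inr rfl)) ?_ ?_ ?_ ?_
    · intro run hrun
      obtain ⟨hrun, hne⟩ | rfl := mem_replaceRun.mp hrun
      · exact .inr ⟨hrun, fun hr => hne (hd.runs_injOn hrun hmem (hr.trans hrid))⟩
      · exact .inl rfl
    · intro run hrun
      by_cases hr : run = (ι, Event.mapTerm lam' f e' :: el)
      · exact .inr (by rw [hr]; exact hrid.symm)
      · exact .inl (mem_replaceRun.mpr (.inl ⟨hrun, hr⟩))
    · intro run' hr₁ hr₂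
      have hne : run'.1.rid ≠ (T ι).rid := by
        obtain heq | heq := hact.rid <;> rw [heq, ← hrid] <;> assumption
      exact mem_replaceRun_of_rid_ne hne (by rwa [hrid'])
    · refine hact.next ι₁ _ hok hrid (mem_replaceRun.mpr (.inr rfl)) fun run hrun => ?_
      exact (mem_replaceRun.mp hrun).imp_left And.left
  · exact hs.input.append fun ℓ r he => (hex'.ne_create ℓ r he).elim
  · refine hs.claims.append (fun e he => by simp [he]) ?_
    intro ι₂ ℓ' r m' hm hℓ'
    obtain ⟨rfl, he⟩ := Prod.mk.inj (List.mem_singleton.mp hm)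
    obtain ⟨hlam, hlab⟩ := hact.label (by rw [← he]; exact hℓ')
    cases e' with
    | claim ℓ r₀ cl arg =>
      obtain _ | m := arg
      · simp [Event.mapTerm] at he
      simp only [Event.mapTerm, Option.map_some, Event.claim.injEq, Option.some.injEq] at he
      obtain ⟨rfl, rfl, rfl, rfl⟩ := he
      refine ⟨T ι₂, ℓ, m, by simp, hact.translates.agents ι₂, hlam, hlab, ?_⟩
      rintro t ⟨rs₀, hrs₀, hev⟩
      rw [hact.context rs₀ hrs₀] at hev
      exact ⟨rs, hact.context', hact.translates.eval _ _ _ hok hact.idents hev⟩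
    | _ => simp [Event.mapTerm] at he

theorem exists_simulates_of_create (h : ChainSetting K P Q c d Prots lam) {α α' : Trace S}
    {s s₁ s' : State S} {ι : Instantiation S} {ℓ : S.Label} {r : S.Role}
    {el : List (Event S)} (hs : Simulates w P Q c d Prots lam K α s α' s')
    (hinit : IsInitialRun ({chain lam P Q c d} ∪ Prots) (ι, .create ℓ r :: el))
    (hrid : ∀ run ∈ s.runs, run.1.rid ≠ ι.rid) (hK : s₁.knowledge = s.knowledge)
    (hF : s₁.runs = s.runs ∪ {(ι, el)})
    (hcomp : ι.rid ∈ w.composed ↔ ℓ ∈ (chain lam P Q c d).labels) (hQ : Q ∉ Prots)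
    (hPQ : P ≠ Q) :
    ∃ α'' s'', Simulates w P Q c d Prots lam K (α ++ [(ι, .create ℓ r)]) s₁ α'' s'' := by
  have hfresh : ∀ run ∈ s'.runs, run.1.rid ≠ w.fst ι.rid ∧ run.1.rid ≠ w.snd ι.rid := by
    intro run' hrun'
    obtain ⟨run, hrun, hr⟩ := hs.runs.origin run' hrun'
    exact w.ne_of_rid_ne (hrid run hrun) hr
  -- In both cases below the simulating system creates one run, with identifier `fst ι.rid` and a
  -- label outside `Q`; a `Q`-run is never created at this stage.
  have key : ∀ (ι' : Instantiation S) (ℓ' : S.Label) (el' : List (Event S)),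
      ι'.rid = w.fst ι.rid → ℓ' ∉ Q.labels →
      IsInitialRun ({P, Q} ∪ Prots) (ι', .create ℓ' r :: el') →
      RunSim w P Q c d Prots lam (s'.runs ∪ {(ι', el')}) (ι, el) →
      ∃ α'' s'', Simulates w P Q c d Prots lam K (α ++ [(ι, .create ℓ r)]) s₁ α'' s'' := by
    intro ι' ℓ' el' hι' hℓ' hinit' hsim
    have hstep := Step.create (K := s'.knowledge) hinit' fun run hrun => by
      rw [hι']
      exact (hfresh run hrun).1
    refine ⟨_, _, hs.derives.snoc hstep, by rw [hK]; exact hs.knowledge, ?_, ?_, ?_⟩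
    · rw [hF]
      refine hs.runs.update (new := (ι, el)) (.inr rfl) ?_ (fun run hrun => .inl (.inl hrun)) ?_ hsim
      · rintro run (hrun | rfl)
        · exact .inr ⟨hrun, hrid run hrun⟩
        · exact .inl rfl
      · intro run' hr₁ _
        refine ⟨?_, .inl⟩
        rintro (h | rfl)
        · exact h
        · exact (hr₁ hι').elim
    · refine hs.input.append fun ℓ₀ r₀ he => ?_
      cases he
      exact hℓ'
    · exact hs.claims.append (fun e he => by simp [he]) (by intro; simp)
  obtain ⟨R, hR, r', rs, hr', hev, hag, hval⟩ := hinit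
  dsimp only at hev hag hval
  have hlab : ℓ ∈ R.labels := Protocol.mem_labels hr' (e := .create ℓ r) (by simp [← hev])
  by_cases hRc : R = chain lam P Q c d
  · subst hRc
    obtain ⟨rs₁, rs₂, h₁, h₂, rfl⟩ := exists_of_chain_eq_some hr'
    obtain ⟨ℓ₁, ℓ₂, inner, hshape, -⟩ := (h.first_wellFormed h₁).shape
    have hdrop : rs₁.events.dropLast = .create ℓ₁ r' :: inner := by
      rw [hshape, ← List.cons_append, List.dropLast_concat]
    rw [chain_events, hdrop, List.map_cons, List.cons_append] at hev
    obtain ⟨hcr, rfl⟩ := List.cons.inj hev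
    simp only [Event.mapTerm, Event.create.injEq] at hcr
    obtain ⟨rfl, rfl⟩ := hcr
    have hlab₁ : ℓ₁ ∈ P.labels := Protocol.mem_labels h₁ (e := .create ℓ₁ r) (by simp [hshape])
    have hdom : {r' | (ι.agents r').isSome} = P.dom := by
      rw [hag]
      ext r₀
      simp only [Protocol.dom, Set.mem_ofPred_eq]
      constructor
      · intro h₀
        obtain ⟨rs₀, h₀⟩ := Option.isSome_iff_exists.mp h₀
        obtain ⟨_, _, h₁, -⟩ := exists_of_chain_eq_some h₀
        simp [h₁]
      · intro h₀
        have h₀' : r₀ ∈ Q.dom := h.chainDefined.dom_eq ▸ h₀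
        obtain ⟨rs₁, h₁⟩ := Option.isSome_iff_exists.mp h₀
        obtain ⟨rs₂, h₂⟩ := Option.isSome_iff_exists.mp h₀'
        simp [chain_eq_some h₁ h₂]
    have hval : ∀ x, (ι.values x).isSome ↔ chainType rs₁ rs₂ c d x = some .param :=
      Set.ext_iff.mp hval
    refine key (w.first Q.idents rs₁ ι) ℓ₁ (inner ++ [.finish ℓ₂ r]) rfl ?_ ?_ ?_
    · exact fun hQℓ => hPQ (h.split.eq_of_label (.inl (.inl rfl)) (.inl (.inr rfl)) hlab₁ hQℓ)
    · refine ⟨P, .inl (.inl rfl), r, rs₁, h₁, hshape.symm, hdom, ?_⟩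
      ext x
      by_cases hx : (rs₁.type x).isSome
      · simpa [RunSplit.first, hx, chainType_of_first hx] using hval x
      · have : rs₁.type x ≠ some .param := by
          rintro h
          simp [h] at hx
        simp [RunSplit.first, hx, this]
    · refine .inr (.inl ⟨h₁, h₂, ?_, by simp [hshape], ⟨hcomp.mpr hlab, hdom, ?_⟩, .inr rfl, ?_⟩)
      · intro e he
        simp [hdrop, he]
      · intro x hx hxc hxd
        have hx₁ : rs₁.type x = none := by
          rw [← Option.not_isSome_iff_eq_none]
          exact fun h' => h.not_mem_idents h₁ x h' (Protocol.mem_idents h₂ hx)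
        rw [hval, chainType_of_second hx₁ hxc hxd]
      · rintro run (hrun | rfl)
        · exact (hfresh run hrun).2
        · exact w.fst_ne_snd _ _
  · have hR : R ∈ Prots := hR.resolve_left hRc
    refine key (w.whole Q.idents ι) ℓ el rfl ?_ ?_ ?_
    -- If `Q` were itself in `Prots`, it could be created here without a chained input.
    · intro hQℓ
      exact hQ (h.split.eq_of_label (.inr hR) (.inl (.inr rfl)) hlab hQℓ ▸ hR)
    · refine ⟨R, .inr hR, r', rs, hr', hev, hag, ?_⟩
      simpa [RunSplit.whole] using hval
    · refine .inl ⟨hR, hRc, hr', fun e he => by simp [← hev, he], ?_, .inr rfl⟩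
      rw [hcomp]
      exact fun hℓ => hRc (h.comp.eq_of_label (.inr hR) (.inl rfl) hlab hℓ)

/-- Every trace of the protocol set with the chaining composition is simulated by a trace of the
protocol set with its parts. -/
theorem exists_simulates (h : ChainSetting K P Q c d Prots lam) (hQ : Q ∉ Prots) (hPQ : P ≠ Q)
    (hK : K.terms ({chain lam P Q c d} ∪ Prots) ⊆ K.terms ({P, Q} ∪ Prots)) {α : Trace S}
    {s : State S} (hd : Derives K ({chain lam P Q c d} ∪ Prots) α s)
    (hcomp : ∀ ι ℓ r, (ι, Event.create ℓ r) ∈ α →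
      (ι.rid ∈ w.composed ↔ ℓ ∈ (chain lam P Q c d).labels)) :
    ∃ α' s', Simulates w P Q c d Prots lam K α s α' s' := by
  induction hd with
  | nil =>
    refine ⟨[], _, .nil, fun t ht => ?_, ⟨by simp, by simp⟩, by intro; simp, by intro; simp⟩
    refine Closure.rename _ (fun t ht => ?_) ht
    rw [(K.noFresh _ t ht).rename_eq]
    exact .base (hK ht)
  | @snoc α e s s₁ hd hstep ih =>
    obtain ⟨α', s', hs⟩ := ih fun ι ℓ r hm => hcomp ι ℓ r (by simp [hm])
    obtain ⟨ℓ, r, el, he, hinit, hrid, hK₁, hF⟩ | ⟨ι, el, hmem, hfin, hex, hF⟩ :=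
      hstep.create_or_executes
    · obtain ⟨ι, e⟩ := e
      obtain rfl : e = .create ℓ r := he
      exact h.exists_simulates_of_create hs hinit hrid hK₁ hF (hcomp ι ℓ r (by simp)) hQ hPQ
    · obtain hsim | hsim | hsim := hs.runs.sim _ hmem
      · exact exists_simulates_of_active hs hd hmem hfin hex hF (h.active_of_wholeSim hsim)
      · obtain hact | hp := h.active_or_pending_of_firstSim hsim
        · exact exists_simulates_of_active hs hd hmem hfin hex hF hact
        -- The simulating system first passes from `P` to `Q`; the event is then executed by the new
        -- `Q`-run.
        · obtain ⟨α'', s'', hs'', hsim'⟩ := h.exists_simulates_secondSim hs hd hmem hp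
          exact exists_simulates_of_active hs'' hd hmem hfin hex hF (h.active_of_secondSim hsim')
      · exact exists_simulates_of_active hs hd hmem hfin hex hF (h.active_of_secondSim hsim)

/-! ### Labels of secrecy claims -/

/-- A claim event is neither the dropped finish event nor the dropped create event, and equality of
the domains gives its role a counterpart in the other protocol. -/
theorem mem_chain_labels (h : ChainSetting K P Q c d Prots lam) {ℓ : S.Label}
    (hℓ : IsSecretLabel P ℓ ∨ IsSecretLabel Q ℓ) : lam ℓ ∈ (chain lam P Q c d).labels := by
  have hdom : ∀ r, (P r).isSome ↔ (Q r).isSome := Set.ext_iff.mp h.chainDefined.dom_eq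
  obtain ⟨r, rs₁, m, h₁, he⟩ | ⟨r, rs₂, m, h₂, he⟩ := hℓ
  · obtain ⟨rs₂, h₂⟩ := Option.isSome_iff_exists.mp ((hdom r).mp (by simp [h₁]))
    refine ⟨r, _, chain_eq_some h₁ h₂, (Event.claim ℓ r .secret (some m)).mapTerm lam id, ?_, rfl⟩
    rw [chain_events]
    refine List.mem_append_left _ (List.mem_map_of_mem ?_)
    obtain ⟨ℓ₁, ℓ₂, inner, hshape, -⟩ := (h.first_wellFormed h₁).shape
    rw [hshape] at he ⊢
    rw [← List.cons_append, List.dropLast_concat]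
    simpa using he
  · obtain ⟨rs₁, h₁⟩ := Option.isSome_iff_exists.mp ((hdom r).mpr (by simp [h₂]))
    refine ⟨r, _, chain_eq_some h₁ h₂,
      (Event.claim ℓ r .secret (some m)).mapTerm lam (RoleTerm.subst c d), ?_, rfl⟩
    rw [chain_events]
    refine List.mem_append_right _ (List.mem_map_of_mem ?_)
    obtain ⟨ℓ₁, ℓ₂, inner, hshape, -⟩ := (h.second_wellFormed h₂).shape
    rw [hshape] at he ⊢
    simpa using he

/-- The claim provides a role; if `P` and `Q` coincided, the parameter `d` of that role would be an
identifier of both. -/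
theorem ne_of_isSecretLabel (h : ChainSetting K P Q c d Prots lam) {ℓ : S.Label}
    (hℓ : IsSecretLabel P ℓ ∨ IsSecretLabel Q ℓ) : P ≠ Q := by
  rintro rfl
  obtain ⟨r, rs, m, hr, -⟩ := or_self_iff.mp hℓ
  have hd : d ∈ P.idents :=
    Protocol.mem_idents hr (by simp [h.chainDefined.param r rs hr])
  exact Set.disjoint_left.mp h.chainDefined.idents_disjoint hd hd

end ChainSetting

end SecProt

/-! ### Transfer of an attack -/

open SecProt in
theorem mainTheorem7 (S : Signature) (K : InitialKnowledge S) (P Q : Protocol S)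
    (c d : S.Ident) (hchain : ChainDefined K P Q c d)
    (Prots : Set (Protocol S)) (hP : P ∉ Prots) (hQ : Q ∉ Prots)
    (hsplit : IsProtocolSet ({P, Q} ∪ Prots))
    (lam : S.Label → S.Label)
    (hlam : Set.InjOn lam (Protocol.labels P ∪ Protocol.labels Q))
    (hcomp : IsProtocolSet ({chain lam P Q c d} ∪ Prots))
    (hK : K.terms ({chain lam P Q c d} ∪ Prots) ⊆ K.terms ({P, Q} ∪ Prots))
    (ℓ : S.Label) (hℓ : IsSecretLabel P ℓ ∨ IsSecretLabel Q ℓ) :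
    Satisfies K .secret (secrecy K) ({P, Q} ∪ Prots)
        (UniqueInput ({P, Q} ∪ Prots) {P} {Q} c d) ℓ →
      Satisfies K .secret (secrecy K) ({chain lam P Q c d} ∪ Prots) (fun _ => True)
        (lam ℓ) := by
  intro hsat α _ _ ι r arg hmem
  have h : ChainSetting K P Q c d Prots lam := ⟨hchain, hsplit, hcomp⟩
  by_contra hcon
  rw [not_or] at hcon
  obtain ⟨hsec, htrust⟩ := hcon
  refine hsec fun ℓ₁ r₁ m harg t hden ht => ?_
  obtain ⟨-, rfl, -, rfl⟩ := Event.claim.inj harg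
  obtain ⟨s, hd, ht⟩ := ht
  -- Which identifiers belong to composed runs is read off the whole trace in advance, so the
  -- renaming stays fixed throughout the simulation.
  obtain ⟨w, hw⟩ := RunSplit.exists_composed_eq {rid | ∃ ι ℓ r, (ι, Event.create ℓ r) ∈ α ∧
    ℓ ∈ (chain lam P Q c d).labels ∧ ι.rid = rid}
  obtain ⟨α', s', hs⟩ := h.exists_simulates (w := w) hQ (h.ne_of_isSecretLabel hℓ) hK hd (by
    intro ι ℓ r hm
    rw [hw]
    refine ⟨?_, fun hℓ => ⟨ι, ℓ, r, hm, hℓ, rfl⟩⟩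
    -- An identifier is created only once, so it cannot belong both to a composed run and to a run
    -- of another protocol.
    rintro ⟨ι', ℓ', r', hm', hℓ', hrid⟩
    rwa [hd.create_unique hm hm' hrid.symm])
  obtain ⟨ι', ℓ', m', hmem', hag, hlam', hℓ', hden'⟩ :=
    hs.claims ι (lam ℓ) r m hmem (h.mem_chain_labels hℓ)
  have hℓPQ : ℓ ∈ P.labels ∪ Q.labels :=
    hℓ.imp (fun ⟨_, _, _, hr, he⟩ => Protocol.mem_labels hr he)
      (fun ⟨_, _, _, hr, he⟩ => Protocol.mem_labels hr he)
  -- Injectivity of the relabelling shows that the matching claim carries the label for which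
  -- secrecy is assumed.
  obtain rfl := hlam hℓ' hℓPQ hlam'
  obtain hsec' | ⟨r', a, ha, htr⟩ := hsat α' ⟨s', hs.derives⟩
    (hs.input.uniqueInput hsplit hchain.param) ι' r (some m') hmem'
  · exact hsec' ℓ' r m' rfl _ (hden' t hden) ⟨s', hs.derives, hs.knowledge t ht⟩
  · exact htrust ⟨r', a, hag ▸ ha, htr⟩
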